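/- Throughout, $\log$ is the natural logarithm, distributions on $[n]$ are identified with their probability vectors, and $\|\cdot\|_2$ is the Euclidean norm. For a finite sample of elements of $[n]$, its configuration is $(c_1,\dots,c_n)$, where $c_i$ is the number of times $i$ was selected. All samples below are fresh and independent. *Pattern sampling* from a distribution $D$ with configuration $(c_1,\dots,c_n)$: with $m=\max_i c_i$, draw $s_1,\dots,s_m$ from $D$ and output the multiset of those $s_i$ with $c_{s_i}\ge i$. *Norm estimation* of $D$ with accuracy parameter $l\in\mathbb N$: draw $l$ samples from $D$ and let $(c_i)$ be their configuration. If $\max_i c_i\ge\log l$, report failure. Otherwise run pattern sampling from $D$ with $(c_i)$ $l$ times, and report $\frac1{l^2}\sum_{j=1}^l r_j$, where $r_j$ is the size of the $j$-th output (an estimate of $\|D\|_2^2$). *The algorithm.* Let $\alpha>0$, $\alpha\neq1$. Put $s=60\,|\log\alpha|^{7/2}/\alpha$, $\sigma=1/\alpha$, $l=\lceil 30\,\sigma\,|\log\sigma|^{3/2}\rceil$ and $k=\max\{0,\lceil 2\log_2 s\rceil\}$. Given sampling access to $P$, $Q$ and $T$: 1. For $i=1,\dots,k$ compute norm estimates $\tilde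 P_i,\tilde Q_i,\tilde T_i$ of $P$, $Q$, $T$ with accuracy parameter $l$. If one of them fails, the whole algorithm fails. 2. If $\tilde T_i>\tilde P_i$ for all $i$, or $\tilde T_i<\tilde P_i$ for all $i$, answer "$Q$" and stop. 3. If $\tilde T_i>\tilde Q_i$ for all $i$, or $\tilde T_i<\tilde Q_i$ for all $i$, answer "$P$" and stop. 4. Otherwise draw $l$ samples from $P$ and $l$ samples from $Q$, with configurations $C_P$ and $C_Q$. Run pattern sampling from $T$ $\lceil\sigma\rceil$ times with $C_P$ and $\lceil\sigma\rceil$ times with $C_Q$, and let $c_P$, $c_Q$ be the total sizes of the outputs. Answer "$P$" if $c_P>c_Q$ and "$Q$" otherwise. **Theorem.** There is a universal constant $c>0$ such that the following holds for every $n$, every $\alpha>0$ with $\alpha\ne1$, and all distributions $P=(p_i)$, $Q=(q_i)$ on $[n]$. If $$\frac{\|P-Q\|_2^2}{\|P+Q\|_2}\ge\alpha\qquad\text{and}\qquad p_i,\,q_i\le\frac1{2s}\ \text{ for all } i,$$ then for $T=P$ the algorithm answers "$P$", and for $T=Q$ it answers "$Q$", in each case with probability at least $1-c/s^2$. More precisely,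 with at least this probability the answer is correct and the total number of samples drawn from $P$, $Q$ and $T$ is at most $c\,s$, a bound that does not depend on $n$. -/

import Mathlib

noncomputable section

namespace Distinguishing

/-- The vector of probabilities of a distribution on `[n]`, in Euclidean space, so that its norm
is the 2-norm. -/
def probVec {n : ℕ} (P : PMF (Fin n)) : EuclideanSpace ℝ (Fin n) :=
  WithLp.toLp 2 fun i => (P i).toReal

/-- A randomized computation that may draw samples; the state counts the samples drawn so far. -/
abbrev Sampler (A : Type) : Type := StateT ℕ PMF A

/-- Draw one fresh sample from the black box `D`; this costs one sample. -/
def draw {n : ℕ} (D : PMF (Fin n)) : Sampler (Fin n) :=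
  fun k => D.map fun x => (x, k + 1)

/-- Run a computation `k` times, with fresh randomness, and list the results. -/
def repeatTimes {A : Type} (x : Sampler A) : ℕ → Sampler (List A)
  | 0 => pure []
  | k + 1 => do
      let a ← x
      let as ← repeatTimes x k
      pure (a :: as)

/-- The joint law of the output of a computation and of the total number of samples it draws. -/
def runSampler {A : Type} (x : Sampler A) : PMF (A × ℕ) := x 0

/-- The configuration of a sample: how many times each element was selected. -/
def configuration {n : ℕ} (xs : List (Fin n)) : Fin n → ℕ := fun x => xs.count x

/-- The largest entry of a configuration. -/
def maxCount {n : ℕ} (c : Fin n → ℕ) : ℕ := Finset.univ.sup c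

/-- Sampling according to a given pattern: draw `m = max c` elements `s_1, …, s_m` from `D` and
keep `s_i` whenever `c (s_i) ≥ i`. (`List.zipIdx` counts positions from `0`.) -/
def patternSample {n : ℕ} (D : PMF (Fin n)) (c : Fin n → ℕ) : Sampler (Multiset (Fin n)) := do
  let xs ← repeatTimes (draw D) (maxCount c)
  pure (((xs.zipIdx.filter fun y => decide (y.2 + 1 ≤ c y.1)).map Prod.fst : List (Fin n)) :
    Multiset (Fin n))

/-- The total number of elements selected in `r` independent runs of `patternSample`. -/
def patternHits {n : ℕ} (D : PMF (Fin n)) (c : Fin n → ℕ) (r : ℕ) : Sampler ℕ := do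
  let S ← repeatTimes (patternSample D c) r
  pure (S.map Multiset.card).sum

open Classical in
/-- Estimation of the squared 2-norm of `D` with accuracy parameter `l`; `none` is the report of
a failure. -/
def estimateNorm {n : ℕ} (D : PMF (Fin n)) (l : ℕ) : Sampler (Option ℝ) := do
  let xs ← repeatTimes (draw D) l
  if Real.log l ≤ maxCount (configuration xs) then
    pure none
  else do
    let h ← patternHits D (configuration xs) l
    pure (some ((h : ℝ) / (l : ℝ) ^ 2))

/-- Norm estimates for `P`, `Q` and `T` obtained in one round. -/
structure Estimates where
  normP : ℝ
  normQ : ℝ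
  normT : ℝ

/-- One round of norm estimates; `none` if one of the three estimations reports a failure. -/
def estimateRound {n : ℕ} (P Q T : PMF (Fin n)) (l : ℕ) : Sampler (Option Estimates) := do
  let a ← estimateNorm P l
  let b ← estimateNorm Q l
  let t ← estimateNorm T l
  pure (match a, b, t with
    | some a, some b, some t => some ⟨a, b, t⟩
    | _, _, _ => none)

/-- The two possible answers: the testing sample comes from `P`, or it comes from `Q`. -/
inductive Verdict
  | isP
  | isQ

/-- The collision stage: `l` training samples from each of `P` and `Q`, then `r` pattern samplings
from `T` on each of the two configurations. -/
def collisionStage {n : ℕ} (P Q T : PMF (Fin n)) (l r : ℕ) : Sampler Verdict := do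
  let xP ← repeatTimes (draw P) l
  let xQ ← repeatTimes (draw Q) l
  let hP ← patternHits T (configuration xP) r
  let hQ ← patternHits T (configuration xQ) r
  pure (if hQ < hP then Verdict.isP else Verdict.isQ)

open Classical in
/-- The main algorithm with `k` rounds of norm estimates, accuracy parameter (and training sample
size) `l`, and `r` testing rounds. A failure of a norm estimation makes the whole algorithm
fail, with output `none`. -/
def distinguish {n : ℕ} (k l r : ℕ) (P Q T : PMF (Fin n)) : Sampler (Option Verdict) := do
  let rounds ← repeatTimes (estimateRound P Q T l) k
  match rounds.mapM id with
  | none => pure none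
  | some es =>
      if (∀ e ∈ es, e.normP < e.normT) ∨ (∀ e ∈ es, e.normT < e.normP) then
        pure (some Verdict.isQ)
      else if (∀ e ∈ es, e.normQ < e.normT) ∨ (∀ e ∈ es, e.normT < e.normQ) then
        pure (some Verdict.isP)
      else do
        let v ← collisionStage P Q T l r
        pure (some v)

/-- `s = 60 |log α|^{7/2} / α`. -/
def sampleSize (α : ℝ) : ℝ := 60 * |Real.log α| ^ (7 / 2 : ℝ) / α

/-- The number `2 log₂ s` of rounds of norm estimates. -/
def numRounds (α : ℝ) : ℕ := ⌈2 * Real.logb 2 (sampleSize α)⌉₊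

/-- The accuracy parameter `l = 30 σ |log σ|^{3/2}` for the separation estimate `σ = 1 / α`. -/
def accuracy (α : ℝ) : ℕ := ⌈30 * (1 / α) * |Real.log (1 / α)| ^ (3 / 2 : ℝ)⌉₊

/-- The number `σ = 1 / α` of testing rounds. -/
def numTests (α : ℝ) : ℕ := ⌈1 / α⌉₊

/-- The algorithm for the class of pairs of separation at least `α`. Its parameters depend on `α`
only, and it uses `P`, `Q`, `T` only through samples. -/
def algorithm {n : ℕ} (α : ℝ) (P Q T : PMF (Fin n)) : Sampler (Option Verdict) :=
  distinguish (numRounds α) (accuracy α) (numTests α) P Q T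

/-- The probability that the algorithm outputs the answer `v` and draws, from the three black
boxes together, at most `N` samples. -/
def successProb {n : ℕ} (α : ℝ) (P Q T : PMF (Fin n)) (v : Verdict) (N : ℝ) : ℝ :=
  ((runSampler (algorithm α P Q T)).toOuterMeasure
    {ω | ω.1 = some v ∧ (ω.2 : ℝ) ≤ N}).toReal

end Distinguishing

end

/-! Write `⟨·,·⟩` for the inner product of probability vectors and `a = ‖P + Q‖₂`. The separation
hypothesis says `(⟨P,P⟩ - ⟨P,Q⟩) + (⟨Q,Q⟩ - ⟨P,Q⟩) ≥ αa`. Let `T = P`. If the first bracket is at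
least `αa/4`, samples of `P` collide with `T` noticeably more often than samples of `Q`, and the
collision stage is reliable. Otherwise `⟨Q,Q⟩ - ⟨P,P⟩ ≥ αa/2`, so in every round the norm estimate
of `Q` very probably exceeds that of `T`, and step 3 answers correctly if it is reached. Step 2 is
harmless for a different reason: the estimates of `P` and `T` are then identically distributed and
independent, so each strict order has probability at most `1/2` per round, and at most `2^(-k) ≤
1/s²` over all rounds (`expect_pair_le_half`). For `T = Q` the roles of steps 2 and 3 are exchanged.

Both norm estimates and collision counts are hits of `r` pattern samplings from `T` on `l` samples
from `D`, with mean `rl⟨D,T⟩`. Given the configuration, the hits are a sum of independent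
indicators, so their exponential moments are at most Poisson; their conditional mean is itself a sum
over the samples, and a second Poisson bound averages it (`expect_sampleHits_eexp_le`). All inner
products being at most `a²`, a deviation of `rl·αa/8` has probability at most `exp(-rlα²/768)`.

The bound on the `p_i` and `q_i` makes `l·p_i` tiny, so a multiplicity of `log l` is improbable
(`expect_maxCount_le`); this controls the failures and the cost of pattern sampling together. Unless
`α = e^(-L)` with `L` large, `s` is bounded and a large `c` makes the claim empty. -/

namespace Distinguishing

open scoped ENNReal

/-! ### Expectations, reachable outcomes and independence for sampling computations -/

section ExpectationCalculus

variable {A B : Type}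

/-- The expectation of a function of the output and of the final sample count, when the
computation is started with sample count `m`. -/
noncomputable def expect (x : Sampler A) (f : A → ℕ → ℝ≥0∞) (m : ℕ) : ℝ≥0∞ :=
  ∑' y : A × ℕ, (x m : PMF (A × ℕ)) y * f y.1 y.2

/-- The indicator of a proposition. -/
noncomputable def ind (p : Prop) : ℝ≥0∞ := open Classical in if p then 1 else 0

theorem ind_le_one (p : Prop) : ind p ≤ 1 := by
  unfold ind; split <;> simp

theorem ind_true {p : Prop} (h : p) : ind p = 1 := by simp [ind, h]

theorem ind_false {p : Prop} (h : ¬p) : ind p = 0 := by simp [ind, h]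

theorem ind_mono {p q : Prop} (h : p → q) : ind p ≤ ind q := by
  by_cases hp : p
  · rw [ind_true hp, ind_true (h hp)]
  · rw [ind_false hp]; exact zero_le

theorem ind_le_of_imp {p : Prop} {a : ℝ≥0∞} (h : p → 1 ≤ a) : ind p ≤ a := by
  by_cases hp : p
  · rw [ind_true hp]; exact h hp
  · rw [ind_false hp]; exact zero_le

theorem ind_or_le (p q : Prop) : ind (p ∨ q) ≤ ind p + ind q := by
  by_cases hp : p
  · rw [ind_true hp]; exact (ind_le_one _).trans le_self_add
  · rw [ind_false hp, zero_add]; exact ind_mono fun h => h.resolve_left hp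

theorem expect_pure (a : A) (f : A → ℕ → ℝ≥0∞) (m : ℕ) :
    expect (pure a : Sampler A) f m = f a m := by
  classical
  change ∑' y : A × ℕ, (PMF.pure (a, m)) y * f y.1 y.2 = _
  rw [tsum_eq_single (a, m)]
  · simp
  · intro y hy; simp [PMF.pure_apply, hy]

theorem expect_bind (x : Sampler A) (g : A → Sampler B) (f : B → ℕ → ℝ≥0∞) (m : ℕ) :
    expect (x >>= g) f m = expect x (fun a k => expect (g a) f k) m := by
  change ∑' y : B × ℕ, ((x m : PMF (A × ℕ)).bind fun y => (g y.1 y.2 : PMF (B × ℕ))) y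
    * f y.1 y.2 = _
  simp only [PMF.bind_apply, expect, ← ENNReal.tsum_mul_right, ← ENNReal.tsum_mul_left]
  rw [ENNReal.tsum_comm]
  simp only [mul_assoc]

/-- This is how almost sure facts about the sample count, proved as `Post` statements, enter
probability bounds. -/
theorem expect_mono_of_support {x : Sampler A} {f g : A → ℕ → ℝ≥0∞} {m : ℕ}
    (h : ∀ a k, (a, k) ∈ (x m : PMF (A × ℕ)).support → f a k ≤ g a k) :
    expect x f m ≤ expect x g m := by
  refine ENNReal.tsum_le_tsum fun y => ?_
  by_cases hy : (x m : PMF (A × ℕ)) y = 0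
  · simp [hy]
  · exact mul_le_mul_right (h y.1 y.2 hy) _

theorem expect_mono {x : Sampler A} {f g : A → ℕ → ℝ≥0∞} {m : ℕ}
    (h : ∀ a k, f a k ≤ g a k) : expect x f m ≤ expect x g m :=
  expect_mono_of_support fun a k _ => h a k

theorem expect_add (x : Sampler A) (f g : A → ℕ → ℝ≥0∞) (m : ℕ) :
    expect x (fun a k => f a k + g a k) m = expect x f m + expect x g m := by
  simp only [expect, mul_add, ENNReal.tsum_add]

theorem expect_const_mul (x : Sampler A) (c : ℝ≥0∞) (f : A → ℕ → ℝ≥0∞) (m : ℕ) :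
    expect x (fun a k => c * f a k) m = c * expect x f m := by
  simp only [expect, ← ENNReal.tsum_mul_left, mul_left_comm]

theorem expect_const (x : Sampler A) (c : ℝ≥0∞) (m : ℕ) :
    expect x (fun _ _ => c) m = c := by
  simp only [expect, ENNReal.tsum_mul_right, PMF.tsum_coe, one_mul]

theorem expect_le_of_le {x : Sampler A} {f : A → ℕ → ℝ≥0∞} {c : ℝ≥0∞} {m : ℕ}
    (h : ∀ a k, f a k ≤ c) : expect x f m ≤ c :=
  (expect_mono h).trans_eq (expect_const x c m)

theorem expect_finset_sum {ι : Type} (t : Finset ι) (x : Sampler A) (f : ι → A → ℕ → ℝ≥0∞)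
    (m : ℕ) : expect x (fun a k => ∑ i ∈ t, f i a k) m = ∑ i ∈ t, expect x (f i) m := by
  classical
  induction t using Finset.induction_on with
  | empty => simp [expect_const]
  | insert i t hi ih => simp only [Finset.sum_insert hi, expect_add, ih]

theorem expect_draw {n : ℕ} (D : PMF (Fin n)) (f : Fin n → ℕ → ℝ≥0∞) (m : ℕ) :
    expect (draw D) f m = ∑ i, D i * f i (m + 1) := by
  have : (draw D : Sampler (Fin n)) m = D.bind fun x => PMF.pure (x, m + 1) := rfl
  rw [expect, this]
  simp only [PMF.bind_apply, ← ENNReal.tsum_mul_right, mul_assoc]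
  rw [ENNReal.tsum_comm, tsum_fintype]
  refine Finset.sum_congr rfl fun i _ => ?_
  rw [ENNReal.tsum_mul_left, tsum_eq_single (i, m + 1)]
  · simp
  · intro y hy; simp [PMF.pure_apply, hy]

theorem expect_repeatTimes_zero (x : Sampler A) (f : List A → ℕ → ℝ≥0∞) (m : ℕ) :
    expect (repeatTimes x 0) f m = f [] m := expect_pure _ _ _

theorem expect_repeatTimes_succ (x : Sampler A) (j : ℕ) (f : List A → ℕ → ℝ≥0∞) (m : ℕ) :
    expect (repeatTimes x (j + 1)) f m =
      expect x (fun a k => expect (repeatTimes x j) (fun as k' => f (a :: as) k') k) m := by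
  simp only [repeatTimes, expect_bind, expect_pure]

/-- Independence of the repetitions makes the factors multiply. The hypothesis is uniform in `m`
because each run starts from the count left by the previous one. -/
theorem expect_repeatTimes_prod_le {x : Sampler A} {F : A → ℝ≥0∞} {q : ℝ≥0∞}
    (h : ∀ m, expect x (fun a _ => F a) m ≤ q) (j m : ℕ) :
    expect (repeatTimes x j) (fun as _ => (as.map F).prod) m ≤ q ^ j := by
  induction j generalizing m with
  | zero => simp [expect_repeatTimes_zero]
  | succ j ih =>
    rw [expect_repeatTimes_succ]
    simp only [List.map_cons, List.prod_cons, expect_const_mul]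
    refine (expect_mono fun a k => mul_le_mul_right (ih k) _).trans ?_
    simp only [mul_comm _ (q ^ j), expect_const_mul, pow_succ]
    exact mul_le_mul_right (h m) _

theorem expect_repeatTimes_forall_le {x : Sampler A} {S : A → Prop} {q : ℝ≥0∞}
    (h : ∀ m, expect x (fun a _ => ind (S a)) m ≤ q) (j m : ℕ) :
    expect (repeatTimes x j) (fun as _ => ind (∀ a ∈ as, S a)) m ≤ q ^ j := by
  refine (expect_mono fun as _ => ?_).trans (expect_repeatTimes_prod_le h j m)
  refine ind_le_of_imp fun has => le_of_eq ?_
  rw [List.prod_eq_one]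
  intro y hy
  obtain ⟨a, ha, rfl⟩ := List.mem_map.1 hy
  exact ind_true (has a ha)

theorem expect_repeatTimes_exists_le {x : Sampler A} {S : A → Prop} {q : ℝ≥0∞}
    (h : ∀ m, expect x (fun a _ => ind (S a)) m ≤ q) (j m : ℕ) :
    expect (repeatTimes x j) (fun as _ => ind (∃ a ∈ as, S a)) m ≤ j * q := by
  induction j generalizing m with
  | zero => simp [expect_repeatTimes_zero, ind]
  | succ j ih =>
    rw [expect_repeatTimes_succ]
    have : ∀ a k, expect (repeatTimes x j) (fun as _ => ind (∃ b ∈ a :: as, S b)) k ≤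
        ind (S a) + j * q := by
      intro a k
      simp only [List.mem_cons, exists_eq_or_imp]
      refine (expect_mono fun as _ => ind_or_le _ _).trans ?_
      rw [expect_add, expect_const]
      gcongr
      exact ih k
    refine (expect_mono this).trans ?_
    rw [expect_add, expect_const, Nat.cast_succ, add_mul, one_mul, add_comm]
    gcongr
    exact h m

/-- Every possible outcome of the computation, started with sample count `m`, satisfies `S`. -/
def Post (x : Sampler A) (m : ℕ) (S : A → ℕ → Prop) : Prop :=
  ∀ a k, (a, k) ∈ (x m : PMF (A × ℕ)).support → S a k

theorem Post.mono {x : Sampler A} {m : ℕ} {S S' : A → ℕ → Prop} (h : Post x m S)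
    (hS : ∀ a k, S a k → S' a k) : Post x m S' := fun a k hk => hS a k (h a k hk)

theorem post_pure {a : A} {m : ℕ} {S : A → ℕ → Prop} (h : S a m) :
    Post (pure a : Sampler A) m S := by
  intro b k hk
  have hk' : (b, k) ∈ (PMF.pure (a, m)).support := hk
  rw [PMF.support_pure, Set.mem_singleton_iff, Prod.mk.injEq] at hk'
  rw [hk'.1, hk'.2]; exact h

theorem post_bind {x : Sampler A} {g : A → Sampler B} {m : ℕ} {S : B → ℕ → Prop}
    (h : Post x m fun a k => Post (g a) k S) : Post (x >>= g) m S := by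
  intro b k hk
  have hk' : (b, k) ∈
    ((x m : PMF (A × ℕ)).bind fun y => (g y.1 y.2 : PMF (B × ℕ))).support := hk
  rw [PMF.mem_support_bind_iff] at hk'
  obtain ⟨y, hy, hk'⟩ := hk'
  exact h y.1 y.2 hy b k hk'

theorem post_draw {n : ℕ} (D : PMF (Fin n)) (m : ℕ) :
    Post (draw D) m fun _ k => k = m + 1 := by
  intro b k hk
  have hk' : (b, k) ∈ (D.map fun x => (x, m + 1)).support := hk
  rw [PMF.mem_support_map_iff] at hk'
  obtain ⟨y, -, hy⟩ := hk'
  exact (congrArg Prod.snd hy).symm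

theorem post_repeatTimes {x : Sampler A} {d : ℕ} (h : ∀ m, Post x m fun _ k => k = m + d)
    (j m : ℕ) : Post (repeatTimes x j) m fun _ k => k = m + j * d := by
  induction j generalizing m with
  | zero => exact post_pure (by simp)
  | succ j ih =>
    refine post_bind ((h m).mono fun a k hk => post_bind ((ih k).mono fun as k' hk' => ?_))
    refine post_pure ?_
    rw [hk', hk]; ring

theorem post_repeatTimes_of_forall {x : Sampler A} {S : A → Prop} {b : ℝ}
    (h : ∀ m, Post x m fun a k => S a → (k : ℝ) ≤ m + b) (j m : ℕ) :
    Post (repeatTimes x j) m fun as k => (∀ a ∈ as, S a) → (k : ℝ) ≤ m + j * b := by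
  induction j generalizing m with
  | zero => exact post_pure (by simp)
  | succ j ih =>
    refine post_bind ((h m).mono fun a k hk => post_bind ((ih k).mono fun as k' hk' => ?_))
    refine post_pure fun hS => ?_
    have h1 := hk (hS a (by simp))
    have h2 := hk' fun a ha => hS a (by simp [ha])
    push_cast
    linarith

/-- The law of the output does not depend on the number of samples drawn before. -/
def Oblivious (x : Sampler A) : Prop :=
  ∀ (f : A → ℝ≥0∞) (m m' : ℕ), expect x (fun a _ => f a) m = expect x (fun a _ => f a) m'

theorem oblivious_pure (a : A) : Oblivious (pure a : Sampler A) := fun f m m' => by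
  simp only [expect_pure]

theorem Oblivious.bind {x : Sampler A} {g : A → Sampler B} (hx : Oblivious x)
    (hg : ∀ a, Oblivious (g a)) : Oblivious (x >>= g) := fun f m m' => by
  simp only [expect_bind]
  have : ∀ a k, expect (g a) (fun b _ => f b) k = expect (g a) (fun b _ => f b) 0 :=
    fun a k => hg a f k 0
  simp only [this]
  exact hx _ m m'

theorem oblivious_draw {n : ℕ} (D : PMF (Fin n)) : Oblivious (draw D) := fun f m m' => by
  simp only [expect_draw]

theorem Oblivious.repeatTimes {x : Sampler A} (hx : Oblivious x) (j : ℕ) :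
    Oblivious (repeatTimes x j) := by
  induction j with
  | zero => exact oblivious_pure _
  | succ j ih => exact hx.bind fun a => ih.bind fun as => oblivious_pure _

end ExpectationCalculus

/-! ### Exponential moments of the number of hits -/

/-- The real exponential with values in the extended nonnegative reals. -/
noncomputable def eexp (x : ℝ) : ℝ≥0∞ := ENNReal.ofReal (Real.exp x)

theorem eexp_zero : eexp 0 = 1 := by simp [eexp]

theorem eexp_add (x y : ℝ) : eexp (x + y) = eexp x * eexp y := by
  rw [eexp, Real.exp_add, ENNReal.ofReal_mul (Real.exp_pos x).le]; rfl

theorem eexp_mono {x y : ℝ} (h : x ≤ y) : eexp x ≤ eexp y :=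
  ENNReal.ofReal_le_ofReal (Real.exp_le_exp.2 h)

theorem one_le_eexp {x : ℝ} (h : 0 ≤ x) : 1 ≤ eexp x := eexp_zero ▸ eexp_mono h

theorem eexp_pow (x : ℝ) (j : ℕ) : eexp x ^ j = eexp (j * x) := by
  rw [eexp, ← ENNReal.ofReal_pow (Real.exp_pos x).le, ← Real.exp_nat_mul]; rfl

theorem prod_map_eexp {A : Type} (f : A → ℝ) (as : List A) :
    (as.map fun a => eexp (f a)).prod = eexp (as.map f).sum := by
  induction as with
  | nil => simp [eexp_zero]
  | cons a as ih => simp [eexp_add, ih]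

theorem exp_mul_le_of_mem_unit (t : ℝ) {y : ℝ} (h0 : 0 ≤ y) (h1 : y ≤ 1) :
    Real.exp (t * y) ≤ 1 + y * (Real.exp t - 1) := by
  have := convexOn_exp.2 (Set.mem_univ 0) (Set.mem_univ t) (sub_nonneg.2 h1) h0 (by ring)
  simp only [smul_eq_mul, mul_zero, zero_add, Real.exp_zero, mul_one] at this
  rw [mul_comm t y]; linarith

theorem sum_toReal_eq_one {n : ℕ} (D : PMF (Fin n)) : ∑ i, (D i).toReal = 1 := by
  have h := D.tsum_coe
  rw [tsum_fintype] at h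
  rw [← ENNReal.toReal_sum fun i _ => D.apply_ne_top i, h, ENNReal.toReal_one]

/-- By convexity `exp (t y)` lies below its chord on `[0,1]`, and `1 + u ≤ exp u` turns the average
of the chord into the exponential moment of a Poisson variable of the same mean. -/
theorem sum_mul_eexp_le {n : ℕ} (D : PMF (Fin n)) (t : ℝ) (y : Fin n → ℝ)
    (h0 : ∀ i, 0 ≤ y i) (h1 : ∀ i, y i ≤ 1) :
    ∑ i, D i * eexp (t * y i) ≤ eexp ((Real.exp t - 1) * ∑ i, (D i).toReal * y i) := by
  have : ∀ i, D i * eexp (t * y i) = ENNReal.ofReal ((D i).toReal * Real.exp (t * y i)) := by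
    intro i
    rw [ENNReal.ofReal_mul ENNReal.toReal_nonneg, ENNReal.ofReal_toReal (D.apply_ne_top i)]; rfl
  simp only [this]
  rw [← ENNReal.ofReal_sum_of_nonneg fun i _ => by positivity]
  refine ENNReal.ofReal_le_ofReal ?_
  calc ∑ i, (D i).toReal * Real.exp (t * y i)
      ≤ ∑ i, (D i).toReal * (1 + y i * (Real.exp t - 1)) := by
        gcongr with i; exact exp_mul_le_of_mem_unit t (h0 i) (h1 i)
    _ = (Real.exp t - 1) * ∑ i, (D i).toReal * y i + 1 := by
        simp only [mul_add, mul_one, Finset.sum_add_distrib, sum_toReal_eq_one, Finset.mul_sum]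
        rw [add_comm]; congr 1; exact Finset.sum_congr rfl fun i _ => by ring
    _ ≤ _ := Real.add_one_le_exp _

/-- The draws of one pattern sampling contribute independent indicators. The offset `j` of the
positions is there for the induction on the number of draws. -/
theorem expect_repeat_draw_eexp_filter_le {n : ℕ} (D : PMF (Fin n)) (c : Fin n → ℕ) (t : ℝ)
    (M j m : ℕ) :
    expect (repeatTimes (draw D) M) (fun xs _ => eexp (t *
      ((xs.zipIdx j).filter fun y => decide (y.2 + 1 ≤ c y.1)).length)) m ≤
    eexp ((Real.exp t - 1) * ∑ i ∈ Finset.range M, ∑ x, (D x).toReal *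
      (if j + i + 1 ≤ c x then 1 else 0)) := by
  induction M generalizing j m with
  | zero => simp [expect_repeatTimes_zero, eexp_zero]
  | succ M ih =>
    rw [expect_repeatTimes_succ]
    have key : ∀ a k, expect (repeatTimes (draw D) M) (fun as _ => eexp (t *
        (((a :: as).zipIdx j).filter fun y => decide (y.2 + 1 ≤ c y.1)).length)) k ≤
        eexp ((Real.exp t - 1) * ∑ i ∈ Finset.range M, ∑ x, (D x).toReal *
          (if j + 1 + i + 1 ≤ c x then 1 else 0)) *
        eexp (t * (if j + 1 ≤ c a then 1 else 0)) := by
      intro a k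
      have : ∀ as : List (Fin n), eexp (t *
          (((a :: as).zipIdx j).filter fun y => decide (y.2 + 1 ≤ c y.1)).length) =
          eexp (t * (if j + 1 ≤ c a then 1 else 0)) * eexp (t *
          ((as.zipIdx (j + 1)).filter fun y => decide (y.2 + 1 ≤ c y.1)).length) := by
        intro as
        rw [← eexp_add, List.zipIdx_cons, List.filter_cons]
        by_cases h : j + 1 ≤ c a <;> simp [h]
        ring_nf
      simp only [this, expect_const_mul]
      rw [mul_comm]
      exact mul_le_mul_left (ih (j + 1) k) _
    refine (expect_mono key).trans ?_
    rw [expect_const_mul, expect_draw, Finset.sum_range_succ', mul_add, eexp_add]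
    refine mul_le_mul' (le_of_eq ?_) (sum_mul_eexp_le D t _ (fun i => ?_) fun i => ?_)
    · simp only [add_assoc, add_comm 1]
    · split <;> norm_num
    · split <;> norm_num

theorem sum_range_ite_le_maxCount {n : ℕ} (c : Fin n → ℕ) (x : Fin n) :
    ∑ i ∈ Finset.range (maxCount c), (if i + 1 ≤ c x then (1 : ℝ) else 0) = c x := by
  have h : c x ≤ maxCount c := Finset.le_sup (f := c) (Finset.mem_univ x)
  rw [Finset.sum_boole]
  have : (Finset.range (maxCount c)).filter (fun i => i + 1 ≤ c x) = Finset.range (c x) := by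
    ext i; simp; omega
  rw [this, Finset.card_range]

theorem expect_patternSample_eexp_le {n : ℕ} (D : PMF (Fin n)) (c : Fin n → ℕ) (t : ℝ) (m : ℕ) :
    expect (patternSample D c) (fun S _ => eexp (t * (Multiset.card S))) m ≤
      eexp ((Real.exp t - 1) * ∑ x, (D x).toReal * c x) := by
  have h := expect_repeat_draw_eexp_filter_le D c t (maxCount c) 0 m
  simp only [patternSample, expect_bind, expect_pure, Multiset.coe_card, List.length_map]
  refine h.trans_eq ?_
  rw [Finset.sum_comm]
  simp only [← Finset.mul_sum, zero_add, sum_range_ite_le_maxCount]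

theorem expect_patternHits_eexp_le {n : ℕ} (D : PMF (Fin n)) (c : Fin n → ℕ) (r : ℕ) (t : ℝ)
    (m : ℕ) : expect (patternHits D c r) (fun h _ => eexp (t * h)) m ≤
      eexp ((Real.exp t - 1) * (r * ∑ x, (D x).toReal * c x)) := by
  simp only [patternHits, expect_bind, expect_pure]
  have h := expect_repeatTimes_prod_le (fun m => expect_patternSample_eexp_le D c t m) r m
  rw [eexp_pow] at h
  refine (le_of_eq ?_).trans (h.trans_eq ?_)
  · congr 1; ext S _
    rw [prod_map_eexp]
    congr 1
    induction S with
    | nil => simp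
    | cons a S ih => simp [mul_add, ← ih]
  · congr 1; ring

theorem sum_mul_configuration {n : ℕ} (d : Fin n → ℝ) (xs : List (Fin n)) :
    ∑ x, d x * (configuration xs x : ℝ) = (xs.map d).sum := by
  induction xs with
  | nil => simp [configuration]
  | cons a xs ih =>
    have : ∀ x, d x * (configuration (a :: xs) x : ℝ) =
        (if a = x then d x else 0) + d x * (configuration xs x : ℝ) := by
      intro x
      unfold configuration
      rw [List.count_cons]
      by_cases h : a = x <;> simp [h]
      ring
    simp [this, Finset.sum_add_distrib, ih]

/-- The number of hits of `r` pattern samplings from `T` on the configuration of `l` samples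
from `D`. -/
noncomputable def sampleHits {n : ℕ} (D T : PMF (Fin n)) (l r : ℕ) : Sampler ℕ := do
  let xs ← repeatTimes (draw D) l
  patternHits T (configuration xs) r

/-- Given the configuration, the exponent is a sum of `r * T x` over the training samples `x`. As `r
* T x ≤ 1`, the Poisson bound applies again to these independent terms, whence the iterated
exponential. -/
theorem expect_sampleHits_eexp_le {n : ℕ} (D T : PMF (Fin n)) (l r : ℕ)
    (hr : ∀ i, r * (T i).toReal ≤ 1) (t : ℝ) (m : ℕ) :
    expect (sampleHits D T l r) (fun h _ => eexp (t * h)) m ≤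
      eexp ((Real.exp (Real.exp t - 1) - 1) *
        (r * l * ∑ x, (D x).toReal * (T x).toReal)) := by
  rw [sampleHits, expect_bind]
  refine (expect_mono fun xs k => expect_patternHits_eexp_le T (configuration xs) r t k).trans ?_
  have h1 : ∀ xs : List (Fin n), eexp ((Real.exp t - 1) *
      (r * ∑ x, (T x).toReal * (configuration xs x : ℝ))) =
      (xs.map fun x => eexp ((Real.exp t - 1) * (r * (T x).toReal))).prod := by
    intro xs
    rw [prod_map_eexp, sum_mul_configuration]
    congr 1
    rw [← List.sum_map_mul_left, ← List.sum_map_mul_left]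
  simp only [h1]
  have h2 := expect_repeatTimes_prod_le (x := draw D)
    (F := fun x => eexp ((Real.exp t - 1) * (r * (T x).toReal)))
    (fun m => (expect_draw D _ m).trans_le
      (sum_mul_eexp_le D _ _ (fun i => by positivity) hr)) l m
  rw [eexp_pow] at h2
  refine h2.trans_eq ?_
  congr 1
  simp only [mul_left_comm _ (r : ℝ), ← Finset.mul_sum]
  ring

theorem exp_exp_sub_one_le {t : ℝ} (ht : |t| ≤ 1 / 10) :
    Real.exp (Real.exp t - 1) - 1 ≤ t + 3 * t ^ 2 := by
  have h1 := Real.abs_exp_sub_one_sub_id_le (x := t) (by linarith)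
  have ht' := abs_le.1 ht
  have h1' := abs_le.1 h1
  have hsq : t ^ 2 ≤ 1 / 100 := by nlinarith
  have h2 : |Real.exp t - 1| ≤ 1 := abs_le.2 ⟨by linarith, by linarith⟩
  have h3 := (abs_le.1 (Real.abs_exp_sub_one_sub_id_le h2)).2
  have h4 : |Real.exp t - 1| ≤ 11 / 10 * |t| := by
    have : t ^ 2 ≤ 1 / 10 * |t| := by
      rw [← sq_abs]; nlinarith [abs_nonneg t]
    calc |Real.exp t - 1| = |(Real.exp t - 1 - t) + t| := by ring_nf
      _ ≤ |Real.exp t - 1 - t| + |t| := abs_add_le _ _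
      _ ≤ _ := by linarith
  have h5 : (Real.exp t - 1) ^ 2 ≤ (11 / 10) ^ 2 * t ^ 2 := by
    rw [← sq_abs, ← sq_abs t, ← mul_pow]
    exact pow_le_pow_left₀ (abs_nonneg _) h4 2
  nlinarith [sq_nonneg t]

/-- Markov's inequality for the exponential moment. Leaving the sign of `t` free covers both tails.
-/
theorem expect_sampleHits_ind_le {n : ℕ} (D T : PMF (Fin n)) (l r : ℕ)
    (hr : ∀ i, r * (T i).toReal ≤ 1) {t : ℝ} (ht : |t| ≤ 1 / 10) (y : ℝ) (m : ℕ) :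
    expect (sampleHits D T l r) (fun h _ => ind (t * y ≤ t * h)) m ≤
      eexp (-(t * y) + (t + 3 * t ^ 2) * (r * l * ∑ x, (D x).toReal * (T x).toReal)) := by
  have h1 : ∀ h : ℕ, ind (t * y ≤ t * h) ≤ eexp (-(t * y)) * eexp (t * h) := fun h =>
    ind_le_of_imp fun hy => by rw [← eexp_add]; exact one_le_eexp (by linarith)
  refine (expect_mono fun h _ => h1 h).trans ?_
  rw [expect_const_mul, eexp_add]
  refine mul_le_mul_right ((expect_sampleHits_eexp_le D T l r hr t m).trans (eexp_mono ?_)) _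
  exact mul_le_mul_of_nonneg_right (exp_exp_sub_one_le ht) (by positivity)

/-! ### Upper and lower tails at deviation `rl·αa/8` -/

section Tails

variable {n : ℕ} {D T : PMF (Fin n)} {l r : ℕ} {α a y : ℝ}

theorem expect_sampleHits_ge_le (hr : ∀ i, r * (T i).toReal ≤ 1) (hα : 0 < α) (ha : α ≤ a)
    (hip : ∑ x, (D x).toReal * (T x).toReal ≤ a ^ 2)
    (hy : r * l * (∑ x, (D x).toReal * (T x).toReal) + r * l * (α * a / 8) ≤ y) (m : ℕ) :
    expect (sampleHits D T l r) (fun h _ => ind (y ≤ h)) m ≤ eexp (-(r * l * α ^ 2 / 768)) := by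
  have ha0 : 0 < a := hα.trans_le ha
  -- The parameter `t = α/(48a)` minimizes `-t·αa/8 + 3t²a²`: with `N = rl` the gain is `Nα²/384`
  -- and the quadratic loss half of it. The assumption `α ≤ a` keeps `t` below `1/10`.
  have ht0 : 0 < α / a / 48 := by positivity
  have ht1 : α / a ≤ 1 := (div_le_one ha0).2 ha
  have h := expect_sampleHits_ind_le D T l r hr (t := α / a / 48)
    (by rw [abs_of_pos ht0]; linarith) y m
  simp only [mul_le_mul_iff_right₀ ht0] at h
  refine h.trans (eexp_mono ?_)
  set N : ℝ := r * l
  set p := ∑ x, (D x).toReal * (T x).toReal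
  have hN : 0 ≤ N := by positivity
  have e1 : α / a / 48 * (N * (α * a / 8)) = N * α ^ 2 / 384 := by field_simp; ring
  have e2 : 3 * (α / a / 48) ^ 2 * (N * a ^ 2) = N * α ^ 2 / 768 := by field_simp; ring
  have h1 := mul_le_mul_of_nonneg_left hy ht0.le
  have h2 : 3 * (α / a / 48) ^ 2 * (N * p) ≤ 3 * (α / a / 48) ^ 2 * (N * a ^ 2) := by gcongr
  nlinarith

theorem expect_sampleHits_le_le (hr : ∀ i, r * (T i).toReal ≤ 1) (hα : 0 < α) (ha : α ≤ a)
    (hip : ∑ x, (D x).toReal * (T x).toReal ≤ a ^ 2)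
    (hy : y ≤ r * l * (∑ x, (D x).toReal * (T x).toReal) - r * l * (α * a / 8)) (m : ℕ) :
    expect (sampleHits D T l r) (fun h _ => ind (h ≤ y)) m ≤ eexp (-(r * l * α ^ 2 / 768)) := by
  have ha0 : 0 < a := hα.trans_le ha
  have ht0 : 0 < α / a / 48 := by positivity
  have ht1 : α / a ≤ 1 := (div_le_one ha0).2 ha
  have h := expect_sampleHits_ind_le D T l r hr (t := -(α / a / 48))
    (by rw [abs_neg, abs_of_pos ht0]; linarith) y m
  simp only [neg_mul, neg_le_neg_iff, mul_le_mul_iff_right₀ ht0] at h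
  refine h.trans (eexp_mono ?_)
  set N : ℝ := r * l
  set p := ∑ x, (D x).toReal * (T x).toReal
  have hN : 0 ≤ N := by positivity
  have e1 : α / a / 48 * (N * (α * a / 8)) = N * α ^ 2 / 384 := by field_simp; ring
  have e2 : 3 * (α / a / 48) ^ 2 * (N * a ^ 2) = N * α ^ 2 / 768 := by field_simp; ring
  have h1 := mul_le_mul_of_nonneg_left hy ht0.le
  have h2 : 3 * (α / a / 48) ^ 2 * (N * p) ≤ 3 * (α / a / 48) ^ 2 * (N * a ^ 2) := by gcongr
  nlinarith

end Tails

/-! ### High multiplicities in a sample are improbable -/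

theorem expect_choose_count_le {n : ℕ} (D : PMF (Fin n)) (x : Fin n) (l M m : ℕ) :
    expect (repeatTimes (draw D) l) (fun xs _ => ((xs.count x).choose M : ℝ≥0∞)) m ≤
      l.choose M * D x ^ M := by
  induction l generalizing M m with
  | zero => cases M <;> simp [expect_repeatTimes_zero]
  | succ l ih =>
    cases M with
    | zero => simp [expect_const]
    | succ M =>
      rw [expect_repeatTimes_succ]
      -- Binomial moments follow Pascal's rule: a first draw equal to `x` adds the term with one
      -- element fewer to choose.
      have key : ∀ a k, expect (repeatTimes (draw D) l)
          (fun as _ => (((a :: as).count x).choose (M + 1) : ℝ≥0∞)) k ≤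
          l.choose (M + 1) * D x ^ (M + 1) + (l.choose M * D x ^ M) * ind (a = x) := by
        intro a k
        by_cases h : a = x
        · subst h
          simp only [List.count_cons_self, Nat.choose_succ_succ, Nat.cast_add, expect_add,
            ind_true, mul_one]
          rw [add_comm]
          exact add_le_add (ih _ _) (ih _ _)
        · rw [ind_false h, mul_zero, add_zero]
          simp only [List.count_cons_of_ne h]
          exact ih _ _
      refine (expect_mono key).trans ?_
      rw [expect_add, expect_const, expect_const_mul, expect_draw]
      simp only [ind, mul_ite, mul_one, mul_zero, Finset.sum_ite_eq', Finset.mem_univ, if_true]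
      rw [Nat.choose_succ_succ, Nat.cast_add, pow_succ, add_mul, add_comm]
      refine le_of_eq ?_
      ring

/-- A union bound over `x` through binomial moments. One factor `D x` is kept out of the power and
sums to 1, so the bound does not involve `n`. -/
theorem expect_maxCount_le {n : ℕ} (D : PMF (Fin n)) (l M : ℕ) {ε : ℝ≥0∞}
    (hε : ∀ i, l * D i ≤ ε) (m : ℕ) :
    expect (repeatTimes (draw D) l)
      (fun xs _ => ind (M + 1 ≤ maxCount (configuration xs))) m ≤ l * ε ^ M := by
  have h1 : ∀ xs : List (Fin n), ind (M + 1 ≤ maxCount (configuration xs)) ≤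
      ∑ x, ((xs.count x).choose (M + 1) : ℝ≥0∞) := by
    intro xs
    refine ind_le_of_imp fun h => ?_
    obtain ⟨x, -, hx⟩ := (Finset.le_sup_iff (Nat.succ_pos M)).1 h
    refine le_trans ?_ (Finset.single_le_sum (fun _ _ => zero_le) (Finset.mem_univ x))
    exact_mod_cast Nat.choose_pos hx
  refine (expect_mono fun xs _ => h1 xs).trans ?_
  rw [expect_finset_sum]
  calc _ ≤ ∑ x, (l.choose (M + 1) * D x ^ (M + 1) : ℝ≥0∞) :=
        Finset.sum_le_sum fun x _ => expect_choose_count_le D x l (M + 1) m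
    _ ≤ ∑ x, l * ε ^ M * D x := by
        refine Finset.sum_le_sum fun x _ => ?_
        calc (l.choose (M + 1) * D x ^ (M + 1) : ℝ≥0∞) ≤ (l : ℝ≥0∞) ^ (M + 1) * D x ^ (M + 1) := by
              gcongr; exact_mod_cast Nat.choose_le_pow l (M + 1)
          _ = l * (l * D x) ^ M * D x := by rw [← mul_pow, pow_succ]; ring
          _ ≤ _ := by gcongr; exact hε x
    _ = l * ε ^ M := by
        rw [← Finset.mul_sum, ← tsum_fintype (L := .unconditional _), D.tsum_coe, mul_one]

/-! ### Sample counts, and independence of the law from the running count -/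

section Costs

variable {n : ℕ}

theorem post_repeat_draw (D : PMF (Fin n)) (l m : ℕ) :
    Post (repeatTimes (draw D) l) m fun _ k => k = m + l :=
  (post_repeatTimes (post_draw D) l m).mono fun _ _ h => by rw [h, mul_one]

theorem post_patternHits (D : PMF (Fin n)) (c : Fin n → ℕ) (r m : ℕ) :
    Post (patternHits D c r) m fun _ k => k = m + r * maxCount c := by
  have h : ∀ m, Post (patternSample D c) m fun _ k => k = m + maxCount c := fun m =>
    post_bind ((post_repeat_draw D _ m).mono fun _ _ hk => post_pure hk)
  exact post_bind ((post_repeatTimes h r m).mono fun _ _ hk => post_pure hk)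

theorem oblivious_patternHits (D : PMF (Fin n)) (c : Fin n → ℕ) (r : ℕ) :
    Oblivious (patternHits D c r) := by
  have h : Oblivious (patternSample D c) :=
    ((oblivious_draw D).repeatTimes _).bind fun _ => oblivious_pure _
  exact (h.repeatTimes r).bind fun _ => oblivious_pure _

theorem oblivious_estimateNorm (D : PMF (Fin n)) (l : ℕ) : Oblivious (estimateNorm D l) := by
  refine ((oblivious_draw D).repeatTimes l).bind fun xs => ?_
  split
  · exact oblivious_pure _
  · exact (oblivious_patternHits D _ l).bind fun _ => oblivious_pure _

theorem post_estimateNorm (D : PMF (Fin n)) (l m : ℕ) :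
    Post (estimateNorm D l) m fun a k => a ≠ none → (k : ℝ) ≤ m + (l + l * Real.log l) := by
  refine post_bind ((post_repeat_draw D l m).mono fun xs k hk => ?_)
  split
  · exact post_pure fun h => absurd rfl h
  · rename_i hlog
    refine post_bind ((post_patternHits D _ l k).mono fun h k' hk' => post_pure fun _ => ?_)
    rw [hk', hk]
    push_cast
    have := mul_le_mul_of_nonneg_left (not_le.1 hlog).le (Nat.cast_nonneg (α := ℝ) l)
    linarith

theorem post_estimateRound (P Q T : PMF (Fin n)) (l m : ℕ) :
    Post (estimateRound P Q T l) m fun a k =>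
      a ≠ none → (k : ℝ) ≤ m + 3 * (l + l * Real.log l) := by
  refine post_bind ((post_estimateNorm P l m).mono fun a k1 h1 => ?_)
  refine post_bind ((post_estimateNorm Q l k1).mono fun b k2 h2 => ?_)
  refine post_bind ((post_estimateNorm T l k2).mono fun t k3 h3 => post_pure fun h => ?_)
  rcases a with _ | a
  · exact absurd rfl h
  rcases b with _ | b
  · exact absurd rfl h
  rcases t with _ | t
  · exact absurd rfl h
  have := h1 (by simp)
  have := h2 (by simp)
  have := h3 (by simp)
  linarith

end Costs

/-! ### Norm estimates: failures, symmetry and separation -/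

section NormEstimates

variable {n : ℕ}

theorem expect_estimateNorm_none_le {D : PMF (Fin n)} {l : ℕ} {φ : ℝ≥0∞}
    (h : ∀ m, expect (repeatTimes (draw D) l)
      (fun xs _ => ind (Real.log l ≤ maxCount (configuration xs))) m ≤ φ) (m : ℕ) :
    expect (estimateNorm D l) (fun a _ => ind (a = none)) m ≤ φ := by
  rw [estimateNorm, expect_bind]
  refine (expect_mono fun xs k => ?_).trans (h m)
  split
  · rename_i hl
    rw [ind_true hl, expect_pure]; exact ind_le_one _
  · rw [expect_bind]
    refine expect_le_of_le fun h k' => ?_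
    rw [expect_pure, ind_false (by simp)]; exact zero_le

/-- Without its failure test, norm estimation is `sampleHits D D l l`; the test only removes
outcomes. -/
theorem expect_estimateNorm_some_le (D : PMF (Fin n)) (l : ℕ) (S : ℝ → Prop) (m : ℕ) :
    expect (estimateNorm D l) (fun a _ => ind (∃ v, a = some v ∧ S v)) m ≤
      expect (sampleHits D D l l) (fun h _ => ind (S (h / (l : ℝ) ^ 2))) m := by
  rw [estimateNorm, sampleHits, expect_bind, expect_bind]
  refine expect_mono fun xs k => ?_
  split
  · rw [expect_pure, ind_false (by simp)]; exact zero_le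
  · rw [expect_bind]
    refine expect_mono fun h k' => ?_
    rw [expect_pure]
    exact ind_mono (by simp)

theorem expect_comm {A B : Type} (x : Sampler A) (y : Sampler B) (g : A → B → ℝ≥0∞) :
    expect x (fun a _ => expect y (fun b _ => g a b) 0) 0 =
      expect y (fun b _ => expect x (fun a _ => g a b) 0) 0 := by
  simp only [expect, ← ENNReal.tsum_mul_left]
  rw [ENNReal.tsum_comm]
  simp only [mul_left_comm]

/-- The events `u < v` and `v < u` are disjoint, and exchanging the two independent runs shows that
they are equally likely. -/
theorem expect_pair_lt_le_half (x : Sampler (Option ℝ)) :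
    expect x (fun a _ => expect x (fun b _ => ind (∃ u v, a = some u ∧ b = some v ∧ u < v)) 0) 0
      ≤ 1 / 2 := by
  set g : Option ℝ → Option ℝ → ℝ≥0∞ := fun a b =>
    ind (∃ u v, a = some u ∧ b = some v ∧ u < v)
  have h1 := expect_comm x x g
  have h2 : expect x (fun a _ => expect x (fun b _ => g a b) 0) 0 +
      expect x (fun a _ => expect x (fun b _ => g b a) 0) 0 ≤ 1 := by
    rw [← expect_add]
    simp only [← expect_add]
    refine expect_le_of_le fun a _ => expect_le_of_le fun b _ => ?_
    by_cases h : ∃ u v, a = some u ∧ b = some v ∧ u < v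
    · have h' : ¬∃ u v, b = some u ∧ a = some v ∧ u < v := by
        obtain ⟨u, v, rfl, rfl, huv⟩ := h
        rintro ⟨u', v', h1, h2, h3⟩
        simp only [Option.some.injEq] at h1 h2
        subst h1 h2
        exact lt_asymm huv h3
      simp only [g, ind_false h', add_zero]
      exact ind_le_one _
    · simp only [g, ind_false h, zero_add]
      exact ind_le_one _
  rw [← h1] at h2
  rw [ENNReal.le_div_iff_mul_le (by simp) (by simp), mul_two]
  exact h2

theorem expect_pair_le_half {x : Sampler (Option ℝ)} (hx : Oblivious x) (m : ℕ) :
    expect x (fun a k => expect x (fun b _ =>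
      ind (∃ u v, a = some u ∧ b = some v ∧ u < v)) k) m ≤ 1 / 2 ∧
    expect x (fun a k => expect x (fun b _ =>
      ind (∃ u v, a = some u ∧ b = some v ∧ v < u)) k) m ≤ 1 / 2 := by
  have e : ∀ (g : Option ℝ → Option ℝ → ℝ≥0∞),
      expect x (fun a k => expect x (fun b _ => g a b) k) m =
      expect x (fun a _ => expect x (fun b _ => g a b) 0) 0 := by
    intro g
    simp only [fun a k => hx (fun b => g a b) k 0]
    exact hx _ m 0
  rw [e, e]
  refine ⟨expect_pair_lt_le_half x, ?_⟩
  rw [expect_comm]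
  refine le_trans (le_of_eq ?_) (expect_pair_lt_le_half x)
  congr! 7
  constructor
  · rintro ⟨u, v, h1, h2, h3⟩; exact ⟨v, u, h2, h1, h3⟩
  · rintro ⟨u, v, h1, h2, h3⟩; exact ⟨v, u, h2, h1, h3⟩

/-- The outcome of a round in terms of the three norm estimates. -/
def combineEstimates : Option ℝ → Option ℝ → Option ℝ → Option Estimates
  | some a, some b, some t => some ⟨a, b, t⟩
  | _, _, _ => none

theorem combineEstimates_eq_some {a b t : Option ℝ} {e : Estimates}
    (h : combineEstimates a b t = some e) :
    a = some e.normP ∧ b = some e.normQ ∧ t = some e.normT := by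
  rcases a with _ | a
  · cases h
  rcases b with _ | b
  · cases h
  rcases t with _ | t
  · cases h
  cases h
  exact ⟨rfl, rfl, rfl⟩

theorem combineEstimates_eq_none {a b t : Option ℝ} (h : combineEstimates a b t = none) :
    a = none ∨ b = none ∨ t = none := by
  rcases a with _ | a
  · simp
  rcases b with _ | b
  · simp
  rcases t with _ | t
  · simp
  cases h

theorem expect_estimateRound (P Q T : PMF (Fin n)) (l : ℕ)
    (f : Option Estimates → ℕ → ℝ≥0∞) (m : ℕ) :
    expect (estimateRound P Q T l) f m =
      expect (estimateNorm P l) (fun a k1 => expect (estimateNorm Q l) (fun b k2 =>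
        expect (estimateNorm T l) (fun t k3 => f (combineEstimates a b t) k3) k2) k1) m := by
  simp only [estimateRound, expect_bind, expect_pure]
  rfl

theorem expect_estimateRound_none_le {P Q T : PMF (Fin n)} {l : ℕ} {φ : ℝ≥0∞}
    (hP : ∀ m, expect (estimateNorm P l) (fun a _ => ind (a = none)) m ≤ φ)
    (hQ : ∀ m, expect (estimateNorm Q l) (fun a _ => ind (a = none)) m ≤ φ)
    (hT : ∀ m, expect (estimateNorm T l) (fun a _ => ind (a = none)) m ≤ φ) (m : ℕ) :
    expect (estimateRound P Q T l) (fun a _ => ind (a = none)) m ≤ 3 * φ := by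
  rw [expect_estimateRound]
  have h : ∀ a b t, ind (combineEstimates a b t = none) ≤
      ind (a = none) + (ind (b = none) + ind (t = none)) := fun a b t =>
    (ind_mono combineEstimates_eq_none).trans
      ((ind_or_le _ _).trans (add_le_add le_rfl (ind_or_le _ _)))
  refine (expect_mono fun a k1 => expect_mono fun b k2 => expect_mono fun t k3 => h a b t).trans ?_
  simp only [expect_add, expect_const]
  rw [show (3 : ℝ≥0∞) * φ = φ + (φ + φ) by ring]
  exact add_le_add (hP m) (add_le_add (expect_le_of_le fun a k => hQ k)
    (expect_le_of_le fun a k => expect_le_of_le fun b k' => hT k'))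

theorem expect_estimateRound_normP_normT_le (P Q T : PMF (Fin n)) (l : ℕ) (S : ℝ → ℝ → Prop)
    (m : ℕ) :
    expect (estimateRound P Q T l) (fun o _ => ind (∃ e, o = some e ∧ S e.normP e.normT)) m ≤
      expect (estimateNorm P l) (fun a k => expect (estimateNorm T l) (fun t _ =>
        ind (∃ u v, a = some u ∧ t = some v ∧ S u v)) k) m := by
  rw [expect_estimateRound]
  refine expect_mono fun a k1 => ?_
  -- The estimate of `Q` between the two runs shifts only the count, which by obliviousness does not
  -- affect the law of the estimate of `T`.
  rw [oblivious_estimateNorm T l _ k1 0]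
  refine expect_le_of_le fun b k2 => ?_
  rw [← oblivious_estimateNorm T l _ k2 0]
  refine expect_mono fun t k3 => ind_mono ?_
  rintro ⟨e, h, hS⟩
  obtain ⟨rfl, rfl, rfl⟩ := combineEstimates_eq_some h
  exact ⟨_, _, rfl, rfl, hS⟩

theorem expect_estimateRound_normQ_normT_le (P Q T : PMF (Fin n)) (l : ℕ) (S : ℝ → ℝ → Prop)
    {q : ℝ≥0∞}
    (h : ∀ m, expect (estimateNorm Q l) (fun a k => expect (estimateNorm T l) (fun t _ =>
        ind (∃ u v, a = some u ∧ t = some v ∧ S u v)) k) m ≤ q) (m : ℕ) :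
    expect (estimateRound P Q T l) (fun o _ => ind (∃ e, o = some e ∧ S e.normQ e.normT)) m ≤
      q := by
  rw [expect_estimateRound]
  refine expect_le_of_le fun a k1 => (expect_mono fun b k2 => expect_mono fun t k3 =>
    ind_mono ?_).trans (h k1)
  rintro ⟨e, h, hS⟩
  obtain ⟨rfl, rfl, rfl⟩ := combineEstimates_eq_some h
  exact ⟨_, _, rfl, rfl, hS⟩

/-- If the estimates are in the wrong order, one of them lies on the wrong side of the threshold
`y`. -/
theorem expect_pair_le_of_tails {D T : PMF (Fin n)} {l : ℕ} {y : ℝ} {η : ℝ≥0∞}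
    (hD : ∀ m, expect (sampleHits D D l l) (fun h _ => ind ((h : ℝ) / (l : ℝ) ^ 2 ≤ y)) m ≤ η)
    (hT : ∀ m, expect (sampleHits T T l l) (fun h _ => ind (y ≤ (h : ℝ) / (l : ℝ) ^ 2)) m ≤ η)
    (m : ℕ) :
    expect (estimateNorm D l) (fun a k => expect (estimateNorm T l) (fun t _ =>
        ind (∃ u v, a = some u ∧ t = some v ∧ u ≤ v)) k) m ≤ 2 * η := by
  have h : ∀ a t : Option ℝ, ind (∃ u v, a = some u ∧ t = some v ∧ u ≤ v) ≤
      ind (∃ u, a = some u ∧ u ≤ y) + ind (∃ v, t = some v ∧ y ≤ v) := by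
    intro a t
    refine le_trans (ind_mono ?_) (ind_or_le _ _)
    rintro ⟨u, v, rfl, rfl, huv⟩
    rcases le_total u y with h | h
    · exact Or.inl ⟨u, rfl, h⟩
    · exact Or.inr ⟨v, rfl, h.trans huv⟩
  refine (expect_mono fun a k1 => expect_mono fun t k2 => h a t).trans ?_
  simp only [expect_add, expect_const]
  rw [two_mul]
  exact add_le_add ((expect_estimateNorm_some_le D l (· ≤ y) m).trans (hD m))
    (expect_le_of_le fun a k => (expect_estimateNorm_some_le T l (y ≤ ·) k).trans (hT k))

end NormEstimates

/-! ### The collision stage -/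

section Collision

variable {n : ℕ}

/-- The events `A` and `B` are the bad deviations of the two hit counts. Outside them the answer is
right, and when no multiplicity reaches `log l` the count stays within `N`; a union bound adds the
four probabilities. -/
theorem expect_collisionStage_le {P Q T : PMF (Fin n)} {l r : ℕ} {φ η : ℝ≥0∞} {v : Verdict}
    {A B : ℕ → Prop}
    (hP : ∀ m, expect (repeatTimes (draw P) l)
      (fun xs _ => ind (Real.log l ≤ maxCount (configuration xs))) m ≤ φ)
    (hQ : ∀ m, expect (repeatTimes (draw Q) l)
      (fun xs _ => ind (Real.log l ≤ maxCount (configuration xs))) m ≤ φ)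
    (hA : ∀ m, expect (sampleHits P T l r) (fun h _ => ind (A h)) m ≤ η)
    (hB : ∀ m, expect (sampleHits Q T l r) (fun h _ => ind (B h)) m ≤ η)
    (hv : ∀ a b : ℕ, ¬A a → ¬B b → (if b < a then Verdict.isP else Verdict.isQ) = v)
    {N : ℝ} {m : ℕ} (hN : m + (2 * l + 2 * r * Real.log l) ≤ N) :
    expect (collisionStage P Q T l r) (fun w k => ind (¬(w = v ∧ (k : ℝ) ≤ N))) m ≤
      2 * φ + 2 * η := by
  simp only [collisionStage, expect_bind, expect_pure]
  have key : expect (repeatTimes (draw P) l) (fun xP k1 => expect (repeatTimes (draw Q) l)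
      (fun xQ k2 => expect (patternHits T (configuration xP) r) (fun a k3 =>
        expect (patternHits T (configuration xQ) r) (fun b k4 =>
          ind (¬((if b < a then Verdict.isP else Verdict.isQ) = v ∧ (k4 : ℝ) ≤ N))) k3) k2) k1) m ≤
      expect (repeatTimes (draw P) l) (fun xP k1 => expect (repeatTimes (draw Q) l)
      (fun xQ k2 => expect (patternHits T (configuration xP) r) (fun a k3 =>
        expect (patternHits T (configuration xQ) r) (fun b k4 =>
          (ind (Real.log l ≤ maxCount (configuration xP)) +
          ind (Real.log l ≤ maxCount (configuration xQ))) + (ind (A a) + ind (B b))) k3) k2) k1) m := by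
    refine expect_mono_of_support fun xP k1 h1 => expect_mono_of_support fun xQ k2 h2 =>
      expect_mono_of_support fun a k3 h3 => expect_mono_of_support fun b k4 h4 => ?_
    replace h1 := post_repeat_draw P l m xP k1 h1
    replace h2 := post_repeat_draw Q l k1 xQ k2 h2
    replace h3 := post_patternHits T _ r k2 a k3 h3
    replace h4 := post_patternHits T _ r k3 b k4 h4
    refine le_trans (ind_mono (q := (Real.log l ≤ maxCount (configuration xP) ∨
      Real.log l ≤ maxCount (configuration xQ)) ∨ (A a ∨ B b)) fun h => ?_)
      ((ind_or_le _ _).trans (add_le_add (ind_or_le _ _) (ind_or_le _ _)))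
    by_contra hcon
    push Not at hcon
    obtain ⟨⟨hp, hq⟩, ha, hb⟩ := hcon
    refine h ⟨hv a b ha hb, le_trans ?_ hN⟩
    have e1 := mul_le_mul_of_nonneg_left hp.le (Nat.cast_nonneg (α := ℝ) r)
    have e2 := mul_le_mul_of_nonneg_left hq.le (Nat.cast_nonneg (α := ℝ) r)
    rw [h4, h3, h2, h1]
    push_cast
    linarith
  refine key.trans ?_
  simp only [expect_add, expect_const]
  rw [two_mul, two_mul]
  refine add_le_add (add_le_add (hP m) (expect_le_of_le fun _ k => hQ k)) (add_le_add ?_ ?_)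
  · have hA' := hA m
    rw [sampleHits, expect_bind] at hA'
    refine le_trans (expect_mono fun xP k1 => ?_) hA'
    refine expect_le_of_le fun _ k2 => le_of_eq ?_
    exact oblivious_patternHits T (configuration xP) r (fun a => ind (A a)) k2 k1
  · refine expect_le_of_le fun _ k => ?_
    have hB' := hB k
    rw [sampleHits, expect_bind] at hB'
    refine le_trans (expect_mono fun xQ k1 => ?_) hB'
    refine expect_le_of_le fun _ k2 => le_of_eq ?_
    exact oblivious_patternHits T (configuration xQ) r (fun b => ind (B b)) k2 k1

end Collision

/-! ### Combining the rounds with the collision stage -/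

section Distinguish

variable {n : ℕ}

theorem mem_none_of_mapM_eq_none {A : Type} {os : List (Option A)} (h : os.mapM id = none) :
    none ∈ os := by
  induction os with
  | nil => simp at h
  | cons o os ih =>
    rcases o with _ | a
    · simp
    · rw [List.mapM_cons] at h
      cases h' : os.mapM id with
      | none => exact List.mem_cons_of_mem _ (ih h')
      | some as => simp [h'] at h

theorem eq_map_some_of_mapM_eq_some {A : Type} {os : List (Option A)} {as : List A}
    (h : os.mapM id = some as) : os = as.map some := by
  induction os generalizing as with
  | nil => simp at h; simp [← h]
  | cons o os ih =>
    rw [List.mapM_cons] at h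
    rcases o with _ | a
    · simp at h
    · cases h' : os.mapM id with
      | none => simp [h'] at h
      | some bs =>
        simp [h'] at h
        simp [← h, ih h']

variable {P Q T : PMF (Fin n)} {k l r : ℕ} {φ ξ ζ : ℝ≥0∞} {N : ℝ}

open Classical in
/-- The answer given on the basis of the norm estimates alone, if there is one. -/
noncomputable def earlyVerdict (es : List Estimates) : Option Verdict :=
  if (∀ e ∈ es, e.normP < e.normT) ∨ (∀ e ∈ es, e.normT < e.normP) then some Verdict.isQ
  else if (∀ e ∈ es, e.normQ < e.normT) ∨ (∀ e ∈ es, e.normT < e.normQ) then some Verdict.isP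
  else none

/-- The part of the main algorithm that follows the rounds of norm estimates. -/
noncomputable def decideAfterRounds (P Q T : PMF (Fin n)) (l r : ℕ)
    (os : List (Option Estimates)) : Sampler (Option Verdict) :=
  match os.mapM id with
  | none => pure none
  | some es =>
    match earlyVerdict es with
    | some v => pure (some v)
    | none => do
        let v ← collisionStage P Q T l r
        pure (some v)

theorem distinguish_eq (k l r : ℕ) (P Q T : PMF (Fin n)) :
    distinguish k l r P Q T =
      repeatTimes (estimateRound P Q T l) k >>= decideAfterRounds P Q T l r := by
  unfold distinguish
  congr 1
  funext os
  unfold decideAfterRounds earlyVerdict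
  cases os.mapM id with
  | none => rfl
  | some es =>
    dsimp only
    split_ifs <;> rfl

theorem expect_decideAfterRounds_le {v : Verdict} {S₁ S₂ S₃ : Estimates → Prop}
    (hS : ∀ es : List Estimates, ¬(∀ e ∈ es, S₁ e) → ¬(∀ e ∈ es, S₂ e) →
      earlyVerdict es = some v ∨ (earlyVerdict es = none ∧ ∃ e ∈ es, S₃ e))
    {os : List (Option Estimates)} {j : ℕ}
    (hj : (∀ o ∈ os, o ≠ none) → (j : ℝ) ≤ N) {X : ℝ≥0∞}
    (hX : (∀ o ∈ os, o ≠ none) → (∃ o ∈ os, ∃ e, o = some e ∧ S₃ e) →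
      expect (collisionStage P Q T l r) (fun w j => ind (¬(w = v ∧ (j : ℝ) ≤ N))) j ≤ X) :
    expect (decideAfterRounds P Q T l r os)
      (fun w j => ind (¬(w = some v ∧ (j : ℝ) ≤ N))) j ≤
      ind (∃ o ∈ os, o = none) + (ind (∀ o ∈ os, ∃ e, o = some e ∧ S₁ e) +
        ind (∀ o ∈ os, ∃ e, o = some e ∧ S₂ e)) + X := by
  have h1 : expect (decideAfterRounds P Q T l r os)
      (fun w j => ind (¬(w = some v ∧ (j : ℝ) ≤ N))) j ≤ 1 :=
    expect_le_of_le fun _ _ => ind_le_one _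
  by_cases hn : ∃ o ∈ os, o = none
  · rw [ind_true hn, add_assoc]; exact h1.trans le_self_add
  by_cases hs1 : ∀ o ∈ os, ∃ e, o = some e ∧ S₁ e
  · rw [ind_true hs1]
    exact h1.trans (le_self_add.trans (le_add_self.trans le_self_add))
  by_cases hs2 : ∀ o ∈ os, ∃ e, o = some e ∧ S₂ e
  · rw [ind_true hs2]
    exact h1.trans (le_add_self.trans (le_add_self.trans le_self_add))
  rw [ind_false hn, ind_false hs1, ind_false hs2]
  simp only [add_zero, zero_add]
  have hn' : ∀ o ∈ os, o ≠ none := fun o ho h => hn ⟨o, ho, h⟩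
  unfold decideAfterRounds
  cases h : os.mapM id with
  | none => exact absurd rfl (hn' _ (mem_none_of_mapM_eq_none h))
  | some es =>
    have hos := eq_map_some_of_mapM_eq_some h
    have hs1' : ¬∀ e ∈ es, S₁ e := fun h => hs1 (by simpa [hos] using h)
    have hs2' : ¬∀ e ∈ es, S₂ e := fun h => hs2 (by simpa [hos] using h)
    dsimp only
    rcases hS es hs1' hs2' with hv | ⟨hv, e, he, hs3⟩
    · rw [hv, expect_pure, ind_false]
      · exact zero_le
      · exact not_not.2 ⟨rfl, hj hn'⟩
    · rw [hv, expect_bind]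
      simp only [expect_pure, Option.some.injEq]
      exact hX hn' ⟨some e, by simpa [hos] using he, e, rfl, hs3⟩

/-- If `S₁` or `S₂` holds in all rounds, the norm comparison may mislead; otherwise the early answer
is correct, or it is missing and `S₃` holds in some round. The disjunction `h₃` is the dichotomy of
the proof: either the collision stage is reliable, or `S₃` is improbable and that stage is rarely
reached. -/
theorem expect_distinguish_le {v : Verdict} {S₁ S₂ S₃ : Estimates → Prop}
    (hS : ∀ es : List Estimates, ¬(∀ e ∈ es, S₁ e) → ¬(∀ e ∈ es, S₂ e) →
      earlyVerdict es = some v ∨ (earlyVerdict es = none ∧ ∃ e ∈ es, S₃ e))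
    (hφ : ∀ m, expect (estimateRound P Q T l) (fun o _ => ind (o = none)) m ≤ φ)
    (h₁ : ∀ m, expect (estimateRound P Q T l)
      (fun o _ => ind (∃ e, o = some e ∧ S₁ e)) m ≤ 1 / 2)
    (h₂ : ∀ m, expect (estimateRound P Q T l)
      (fun o _ => ind (∃ e, o = some e ∧ S₂ e)) m ≤ 1 / 2)
    (h₃ : (∀ m : ℕ, (m : ℝ) ≤ k * (3 * (l + l * Real.log l)) →
        expect (collisionStage P Q T l r) (fun w j => ind (¬(w = v ∧ (j : ℝ) ≤ N))) m ≤ ξ) ∨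
      ∀ m, expect (estimateRound P Q T l) (fun o _ => ind (∃ e, o = some e ∧ S₃ e)) m ≤ ζ)
    (hN : k * (3 * (l + l * Real.log l)) ≤ N) :
    expect (distinguish k l r P Q T) (fun w j => ind (¬(w = some v ∧ (j : ℝ) ≤ N))) 0 ≤
      k * φ + ((1 / 2) ^ k + (1 / 2) ^ k) + (ξ + k * ζ) := by
  rw [distinguish_eq, expect_bind]
  have hcost : ∀ os j, (os, j) ∈ ((repeatTimes (estimateRound P Q T l) k) 0 :
      PMF (List (Option Estimates) × ℕ)).support → (∀ o ∈ os, o ≠ none) →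
      (j : ℝ) ≤ k * (3 * (l + l * Real.log l)) := by
    intro os j hj ho
    simpa using post_repeatTimes_of_forall (post_estimateRound P Q T l) k 0 os j hj ho
  have hsum : ∀ X : List (Option Estimates) → ℝ≥0∞,
      expect (repeatTimes (estimateRound P Q T l) k) (fun os _ => X os) 0 ≤ ξ + k * ζ →
      expect (repeatTimes (estimateRound P Q T l) k) (fun os _ => ind (∃ o ∈ os, o = none) +
        (ind (∀ o ∈ os, ∃ e, o = some e ∧ S₁ e) + ind (∀ o ∈ os, ∃ e, o = some e ∧ S₂ e)) +
        X os) 0 ≤ k * φ + ((1 / 2) ^ k + (1 / 2) ^ k) + (ξ + k * ζ) := by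
    intro X hX
    simp only [expect_add]
    exact add_le_add (add_le_add (expect_repeatTimes_exists_le hφ k 0)
      (add_le_add (expect_repeatTimes_forall_le h₁ k 0)
        (expect_repeatTimes_forall_le h₂ k 0))) hX
  rcases h₃ with h₃ | h₃
  · refine le_trans (expect_mono_of_support fun os j hj => ?_)
      (hsum (fun _ => ξ) ((expect_const _ _ _).trans_le le_self_add))
    exact expect_decideAfterRounds_le hS (fun ho => (hcost os j hj ho).trans hN)
      fun ho _ => h₃ j (hcost os j hj ho)
  · refine le_trans (expect_mono_of_support fun os j hj => ?_)
      (hsum (fun os => ind (∃ o ∈ os, ∃ e, o = some e ∧ S₃ e))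
        ((expect_repeatTimes_exists_le h₃ k 0).trans le_add_self))
    refine expect_decideAfterRounds_le hS (fun ho => (hcost os j hj ho).trans hN) fun _ h => ?_
    rw [ind_true h]
    exact expect_le_of_le fun _ _ => ind_le_one _

theorem earlyVerdict_of_not_normP {es : List Estimates}
    (h₁ : ¬∀ e ∈ es, e.normP < e.normT) (h₂ : ¬∀ e ∈ es, e.normT < e.normP) :
    earlyVerdict es = some Verdict.isP ∨
      (earlyVerdict es = none ∧ ∃ e ∈ es, e.normQ ≤ e.normT) := by
  unfold earlyVerdict
  rw [if_neg (not_or.2 ⟨h₁, h₂⟩)]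
  by_cases h : (∀ e ∈ es, e.normQ < e.normT) ∨ (∀ e ∈ es, e.normT < e.normQ)
  · simp [h]
  · rw [if_neg h]
    push Not at h
    exact Or.inr ⟨rfl, h.2⟩

theorem earlyVerdict_of_not_normQ {es : List Estimates}
    (h₁ : ¬∀ e ∈ es, e.normQ < e.normT) (h₂ : ¬∀ e ∈ es, e.normT < e.normQ) :
    earlyVerdict es = some Verdict.isQ ∨
      (earlyVerdict es = none ∧ ∃ e ∈ es, e.normP ≤ e.normT) := by
  unfold earlyVerdict
  rw [if_neg (not_or.2 ⟨h₁, h₂⟩)]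
  by_cases h : (∀ e ∈ es, e.normP < e.normT) ∨ (∀ e ∈ es, e.normT < e.normP)
  · simp [h]
  · rw [if_neg h]
    push Not at h
    exact Or.inr ⟨rfl, h.2⟩

end Distinguish

/-! ### The dichotomy between collisions and norms -/

section ErrorBounds

variable {n : ℕ} {P Q : PMF (Fin n)} {k l r : ℕ} {α a N : ℝ} {φ η : ℝ≥0∞}

theorem expect_distinguish_left_le (hα : 0 < α) (ha : α ≤ a) (hl : 0 < l) (hrl : r ≤ l)
    (hlP : ∀ i, l * (P i).toReal ≤ 1) (hlQ : ∀ i, l * (Q i).toReal ≤ 1)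
    (hPP : ∑ x, (P x).toReal * (P x).toReal ≤ a ^ 2)
    (hQQ : ∑ x, (Q x).toReal * (Q x).toReal ≤ a ^ 2)
    (hPQ : ∑ x, (Q x).toReal * (P x).toReal ≤ a ^ 2)
    (hsep : α * a ≤ ∑ x, (P x).toReal * (P x).toReal + ∑ x, (Q x).toReal * (Q x).toReal -
      2 * ∑ x, (Q x).toReal * (P x).toReal)
    (hP : ∀ m, expect (repeatTimes (draw P) l)
      (fun xs _ => ind (Real.log l ≤ maxCount (configuration xs))) m ≤ φ)
    (hQ : ∀ m, expect (repeatTimes (draw Q) l)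
      (fun xs _ => ind (Real.log l ≤ maxCount (configuration xs))) m ≤ φ)
    (hη : eexp (-(r * l * α ^ 2 / 768)) ≤ η)
    (hN : k * (3 * (l + l * Real.log l)) + (2 * l + 2 * r * Real.log l) ≤ N) :
    expect (distinguish k l r P Q P)
      (fun w j => ind (¬(w = some Verdict.isP ∧ (j : ℝ) ≤ N))) 0 ≤
      k * (3 * φ) + ((1 / 2) ^ k + (1 / 2) ^ k) + ((2 * φ + 2 * η) + k * (2 * η)) := by
  have hl0 : (0 : ℝ) < l := by exact_mod_cast hl
  have hrl' : (r : ℝ) ≤ l := by exact_mod_cast hrl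
  have hrP : ∀ i, r * (P i).toReal ≤ 1 := fun i => le_trans (by gcongr) (hlP i)
  have hηl : eexp (-(l * l * α ^ 2 / 768)) ≤ η := by
    refine le_trans (eexp_mono ?_) hη
    gcongr
  have haα : 0 < α * a := mul_pos hα (hα.trans_le ha)
  have hlog : 0 ≤ 2 * (l : ℝ) + 2 * r * Real.log l := by
    have := Real.log_natCast_nonneg l
    positivity
  have nP := expect_estimateNorm_none_le hP
  have nQ := expect_estimateNorm_none_le hQ
  refine expect_distinguish_le (fun es => earlyVerdict_of_not_normP)
    (expect_estimateRound_none_le nP nQ nP)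
    (fun m => (expect_estimateRound_normP_normT_le P Q P l (· < ·) m).trans
      (expect_pair_le_half (oblivious_estimateNorm P l) m).1)
    (fun m => (expect_estimateRound_normP_normT_le P Q P l (fun u v => v < u) m).trans
      (expect_pair_le_half (oblivious_estimateNorm P l) m).2) ?_ (by linarith)
  set pp := ∑ x, (P x).toReal * (P x).toReal
  set qq := ∑ x, (Q x).toReal * (Q x).toReal
  set qp := ∑ x, (Q x).toReal * (P x).toReal
  -- In the first case the means of the two hit counts are `rl·αa/4` apart, leaving a deviation of
  -- `rl·αa/8` on either side of the threshold. In the second, `hsep` gives `qq - qp ≥ 3αa/4`, hence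
  -- `qq - pp ≥ αa/2`.
  rcases le_total (α * a / 4) (pp - qp) with h | h
  · left
    intro m hm
    refine expect_collisionStage_le (A := fun h => (h : ℝ) ≤ r * l * pp - r * l * (α * a / 8))
      (B := fun h => r * l * pp - r * l * (α * a / 8) ≤ (h : ℝ)) hP hQ
      (fun m => (expect_sampleHits_le_le hrP hα ha hPP le_rfl m).trans hη)
      (fun m => (expect_sampleHits_ge_le hrP hα ha hPQ ?_ m).trans hη) ?_ (by linarith)
    · have : (r * l : ℝ) * (qp + α * a / 8 + α * a / 8) ≤ r * l * pp := by
        gcongr; linarith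
      linarith
    · intro b b' hb hb'
      rw [if_pos]
      exact_mod_cast (not_le.1 hb').trans (not_le.1 hb)
  · right
    refine expect_estimateRound_normQ_normT_le P Q P l (· ≤ ·)
      (expect_pair_le_of_tails (y := qq - α * a / 8) (fun m => ?_) (fun m => ?_))
    · simp only [div_le_iff₀ (pow_pos hl0 2)]
      refine (expect_sampleHits_le_le hlQ hα ha hQQ ?_ m).trans hηl
      change _ ≤ l * l * qq - _
      exact le_of_eq (by ring)
    · simp only [le_div_iff₀ (pow_pos hl0 2)]
      refine (expect_sampleHits_ge_le hlP hα ha hPP ?_ m).trans hηl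
      have : (l : ℝ) ^ 2 * (pp + α * a / 8) ≤ l ^ 2 * (qq - α * a / 8) := by
        gcongr; linarith
      linarith

theorem expect_distinguish_right_le (hα : 0 < α) (ha : α ≤ a) (hl : 0 < l) (hrl : r ≤ l)
    (hlP : ∀ i, l * (P i).toReal ≤ 1) (hlQ : ∀ i, l * (Q i).toReal ≤ 1)
    (hPP : ∑ x, (P x).toReal * (P x).toReal ≤ a ^ 2)
    (hQQ : ∑ x, (Q x).toReal * (Q x).toReal ≤ a ^ 2)
    (hPQ : ∑ x, (P x).toReal * (Q x).toReal ≤ a ^ 2)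
    (hsep : α * a ≤ ∑ x, (P x).toReal * (P x).toReal + ∑ x, (Q x).toReal * (Q x).toReal -
      2 * ∑ x, (P x).toReal * (Q x).toReal)
    (hP : ∀ m, expect (repeatTimes (draw P) l)
      (fun xs _ => ind (Real.log l ≤ maxCount (configuration xs))) m ≤ φ)
    (hQ : ∀ m, expect (repeatTimes (draw Q) l)
      (fun xs _ => ind (Real.log l ≤ maxCount (configuration xs))) m ≤ φ)
    (hη : eexp (-(r * l * α ^ 2 / 768)) ≤ η)
    (hN : k * (3 * (l + l * Real.log l)) + (2 * l + 2 * r * Real.log l) ≤ N) :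
    expect (distinguish k l r P Q Q)
      (fun w j => ind (¬(w = some Verdict.isQ ∧ (j : ℝ) ≤ N))) 0 ≤
      k * (3 * φ) + ((1 / 2) ^ k + (1 / 2) ^ k) + ((2 * φ + 2 * η) + k * (2 * η)) := by
  have hl0 : (0 : ℝ) < l := by exact_mod_cast hl
  have hrl' : (r : ℝ) ≤ l := by exact_mod_cast hrl
  have hrQ : ∀ i, r * (Q i).toReal ≤ 1 := fun i => le_trans (by gcongr) (hlQ i)
  have hηl : eexp (-(l * l * α ^ 2 / 768)) ≤ η := by
    refine le_trans (eexp_mono ?_) hη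
    gcongr
  have haα : 0 < α * a := mul_pos hα (hα.trans_le ha)
  have hlog : 0 ≤ 2 * (l : ℝ) + 2 * r * Real.log l := by
    have := Real.log_natCast_nonneg l
    positivity
  have nP := expect_estimateNorm_none_le hP
  have nQ := expect_estimateNorm_none_le hQ
  refine expect_distinguish_le (fun es => earlyVerdict_of_not_normQ)
    (expect_estimateRound_none_le nP nQ nQ)
    (expect_estimateRound_normQ_normT_le P Q Q l (· < ·) fun m =>
      (expect_pair_le_half (oblivious_estimateNorm Q l) m).1)
    (expect_estimateRound_normQ_normT_le P Q Q l (fun u v => v < u) fun m =>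
      (expect_pair_le_half (oblivious_estimateNorm Q l) m).2) ?_ (by linarith)
  set pp := ∑ x, (P x).toReal * (P x).toReal
  set qq := ∑ x, (Q x).toReal * (Q x).toReal
  set pq := ∑ x, (P x).toReal * (Q x).toReal
  -- The same dichotomy with `P` and `Q` exchanged: the second case gives `pp - qq ≥ αa/2`.
  rcases le_total (α * a / 4) (qq - pq) with h | h
  · left
    intro m hm
    refine expect_collisionStage_le (A := fun h => r * l * qq - r * l * (α * a / 8) ≤ (h : ℝ))
      (B := fun h => (h : ℝ) ≤ r * l * qq - r * l * (α * a / 8)) hP hQ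
      (fun m => (expect_sampleHits_ge_le hrQ hα ha hPQ ?_ m).trans hη)
      (fun m => (expect_sampleHits_le_le hrQ hα ha hQQ le_rfl m).trans hη) ?_ (by linarith)
    · have : (r * l : ℝ) * (pq + α * a / 8 + α * a / 8) ≤ r * l * qq := by
        gcongr; linarith
      linarith
    · intro b b' hb hb'
      rw [if_neg]
      have : (b : ℝ) < b' := (not_le.1 hb).trans (not_le.1 hb')
      exact not_lt.2 (by exact_mod_cast this.le)
  · right
    intro m
    refine (expect_estimateRound_normP_normT_le P Q Q l (· ≤ ·) m).trans
      (expect_pair_le_of_tails (y := pp - α * a / 8) (fun m => ?_) (fun m => ?_) m)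
    · simp only [div_le_iff₀ (pow_pos hl0 2)]
      refine (expect_sampleHits_le_le hlP hα ha hPP ?_ m).trans hηl
      change _ ≤ l * l * pp - _
      exact le_of_eq (by ring)
    · simp only [le_div_iff₀ (pow_pos hl0 2)]
      refine (expect_sampleHits_ge_le hlQ hα ha hQQ ?_ m).trans hηl
      have : (l : ℝ) ^ 2 * (qq + α * a / 8) ≤ l ^ 2 * (pp - α * a / 8) := by
        gcongr; linarith
      linarith

end ErrorBounds

theorem one_sub_le_successProb {n : ℕ} {α N e : ℝ} {P Q T : PMF (Fin n)} {v : Verdict}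
    (he : 0 ≤ e) (h : expect (algorithm α P Q T)
      (fun w j => ind (¬(w = some v ∧ (j : ℝ) ≤ N))) 0 ≤ ENNReal.ofReal e) :
    1 - e ≤ successProb α P Q T v N := by
  have h1 : (runSampler (algorithm α P Q T)).toOuterMeasure
      {ω | ω.1 = some v ∧ (ω.2 : ℝ) ≤ N} =
      expect (algorithm α P Q T) (fun w j => ind (w = some v ∧ (j : ℝ) ≤ N)) 0 := by
    rw [PMF.toOuterMeasure_apply]
    refine tsum_congr fun ω => ?_
    dsimp only
    by_cases hω : ω.1 = some v ∧ (ω.2 : ℝ) ≤ N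
    · rw [Set.indicator_of_mem (by exact hω), ind_true hω, mul_one]; rfl
    · rw [Set.indicator_of_notMem (by exact hω), ind_false hω, mul_zero]
  have h2 : (1 : ℝ≥0∞) ≤ expect (algorithm α P Q T)
      (fun w j => ind (w = some v ∧ (j : ℝ) ≤ N)) 0 + ENNReal.ofReal e := by
    refine le_trans ?_ (add_le_add le_rfl h)
    rw [← expect_add, ← expect_const (algorithm α P Q T) 1 0]
    refine expect_mono fun w j => ?_
    by_cases hω : w = some v ∧ (j : ℝ) ≤ N
    · rw [ind_true hω]; exact le_self_add
    · rw [ind_true hω]; exact le_add_self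
  have h3 : expect (algorithm α P Q T) (fun w j => ind (w = some v ∧ (j : ℝ) ≤ N)) 0 ≠ ⊤ :=
    ne_top_of_le_ne_top ENNReal.one_ne_top (expect_le_of_le fun _ _ => ind_le_one _)
  rw [successProb, h1]
  have h4 := ENNReal.toReal_mono (by simp [h3]) h2
  rw [ENNReal.toReal_add h3 ENNReal.ofReal_ne_top, ENNReal.toReal_ofReal he,
    ENNReal.toReal_one] at h4
  linarith

/-- With `M + 1 = ⌈log l⌉` the multiplicity bound is `l·e^(-11M)`, and `M ≥ log l - 1`. -/
theorem expect_log_le_maxCount_le {n : ℕ} (D : PMF (Fin n)) {l : ℕ} (hl : 2 ≤ l)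
    (hD : ∀ i, l * (D i).toReal ≤ Real.exp (-11)) (m : ℕ) :
    expect (repeatTimes (draw D) l)
      (fun xs _ => ind (Real.log l ≤ maxCount (configuration xs))) m ≤
      eexp (11 - 10 * Real.log l) := by
  have hl0 : (0 : ℝ) < l := by positivity
  have hlog : 0 < Real.log l := Real.log_pos (by exact_mod_cast hl)
  obtain ⟨M, hM⟩ : ∃ M, ⌈Real.log l⌉₊ = M + 1 :=
    Nat.exists_eq_succ_of_ne_zero (Nat.ceil_pos.2 hlog).ne'
  have hε : ∀ i, l * D i ≤ eexp (-11) := by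
    intro i
    rw [← ENNReal.ofReal_toReal (D.apply_ne_top i), ← ENNReal.ofReal_natCast,
      ← ENNReal.ofReal_mul hl0.le]
    exact ENNReal.ofReal_le_ofReal (hD i)
  have h := expect_maxCount_le D l M hε m
  refine (expect_mono fun xs _ => ind_mono fun hx => ?_).trans (h.trans ?_)
  · rw [← hM]; exact Nat.ceil_le.2 hx
  · rw [eexp_pow, ← ENNReal.ofReal_natCast, ← Real.exp_log hl0]
    change eexp _ * _ ≤ _
    rw [← eexp_add, Real.exp_log hl0]
    refine eexp_mono ?_
    have h1 := Nat.le_ceil (Real.log l)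
    rw [hM] at h1
    push_cast at h1
    linarith

/-! ### Euclidean norms as inner products -/

section Norms

variable {n : ℕ} (P Q : PMF (Fin n))

theorem sq_norm_probVec_add : ‖probVec P + probVec Q‖ ^ 2 =
    ∑ x, (P x).toReal * (P x).toReal + ∑ x, (Q x).toReal * (Q x).toReal +
      2 * ∑ x, (P x).toReal * (Q x).toReal := by
  rw [EuclideanSpace.norm_sq_eq, Finset.mul_sum, ← Finset.sum_add_distrib,
    ← Finset.sum_add_distrib]
  refine Finset.sum_congr rfl fun x _ => ?_
  simp only [probVec, PiLp.add_apply, Real.norm_eq_abs, sq_abs]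
  ring

theorem sq_norm_probVec_sub : ‖probVec P - probVec Q‖ ^ 2 =
    ∑ x, (P x).toReal * (P x).toReal + ∑ x, (Q x).toReal * (Q x).toReal -
      2 * ∑ x, (P x).toReal * (Q x).toReal := by
  rw [EuclideanSpace.norm_sq_eq, Finset.mul_sum, ← Finset.sum_add_distrib,
    ← Finset.sum_sub_distrib]
  refine Finset.sum_congr rfl fun x _ => ?_
  simp only [probVec, PiLp.sub_apply, Real.norm_eq_abs, sq_abs]
  ring

theorem sum_toReal_mul_nonneg : 0 ≤ ∑ x, (P x).toReal * (Q x).toReal :=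
  Finset.sum_nonneg fun _ _ => by positivity

theorem norm_probVec_add_pos : 0 < ‖probVec P + probVec Q‖ := by
  have h : 0 < ∑ x, (P x).toReal * (P x).toReal := by
    refine (sum_toReal_mul_nonneg P P).lt_of_ne' fun h0 => ?_
    have h1 := (Finset.sum_eq_zero_iff_of_nonneg fun x _ => by positivity).1 h0
    have h2 := sum_toReal_eq_one P
    rw [Finset.sum_eq_zero fun x hx => mul_self_eq_zero.1 (h1 x hx)] at h2
    exact zero_ne_one h2
  have h3 := sq_norm_probVec_add P Q
  have h4 := sum_toReal_mul_nonneg P Q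
  have h5 := sum_toReal_mul_nonneg Q Q
  have h6 : 0 < ‖probVec P + probVec Q‖ ^ 2 := by linarith
  exact (norm_nonneg _).lt_of_ne' fun h0 => by simp [h0] at h6

end Norms

/-! ### Numerical estimates for `α = e^(-L)` -/

section Parameters

theorem log_le_div_add {x b : ℝ} (hx : 0 < x) (hb : 0 < b) :
    Real.log x ≤ x / b + (b - 2) := by
  have h1 := Real.log_le_sub_one_of_pos (div_pos hx hb)
  have h2 := Real.log_le_sub_one_of_pos hb
  rw [Real.log_div hx.ne' hb.ne'] at h1
  linarith

theorem rpow_seven_half {L : ℝ} (hL : 0 < L) : L ^ (7 / 2 : ℝ) = L ^ 2 * L ^ (3 / 2 : ℝ) := by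
  rw [← Real.rpow_natCast, ← Real.rpow_add hL]; norm_num

/-- The cutoff is `65536 = 256²`, chosen so that `30·256/768 = 10`: the tail exponent `rlα²/768 ≥
30·L^(3/2)/768` is then at least `10L`. -/
theorem mul_le_rpow_three_half {L : ℝ} (hL : 65536 ≤ L) : 256 * L ≤ L ^ (3 / 2 : ℝ) := by
  have h0 : 0 < L := by linarith
  have h : L ^ (3 / 2 : ℝ) = Real.sqrt L * L := by
    rw [Real.sqrt_eq_rpow, ← Real.rpow_add_one h0.ne']; norm_num
  rw [h]
  gcongr
  exact Real.le_sqrt_of_sq_le (by linarith)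

theorem sampleSize_pos {α : ℝ} (hα : 0 < α) (h1 : α ≠ 1) : 0 < sampleSize α := by
  have : 0 < |Real.log α| := abs_pos.2 (Real.log_ne_zero_of_pos_of_ne_one hα h1)
  unfold sampleSize
  positivity

/-- For `log α` between `-65536` and `65536` both factors are bounded; beyond that `1/α` beats the
power of the logarithm. -/
theorem sampleSize_le_of_le {α : ℝ} (hα : 0 < α) (h : -65536 ≤ Real.log α) :
    sampleSize α ≤ 60 * (65536 ^ (7 / 2 : ℝ) * Real.exp 65536) := by
  have hinv : 1 / α = Real.exp (-Real.log α) := by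
    rw [Real.exp_neg, Real.exp_log hα, one_div]
  have key : |Real.log α| ^ (7 / 2 : ℝ) * (1 / α) ≤
      65536 ^ (7 / 2 : ℝ) * Real.exp 65536 := by
    rw [hinv]
    rcases le_or_gt (Real.log α) 65536 with h' | h'
    · gcongr
      · exact abs_le.2 ⟨h, h'⟩
      · linarith
    · have h0 : 0 < Real.log α := by linarith
      rw [abs_of_pos h0, Real.rpow_def_of_pos h0, ← Real.exp_add]
      calc _ ≤ Real.exp 65536 := by
            refine Real.exp_le_exp.2 ?_
            have := log_le_div_add h0 (b := 4) (by norm_num)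
            linarith
        _ ≤ _ := le_mul_of_one_le_left (Real.exp_pos _).le
            (Real.one_le_rpow (by norm_num) (by norm_num))
  calc sampleSize α = 60 * (|Real.log α| ^ (7 / 2 : ℝ) * (1 / α)) := by unfold sampleSize; ring
    _ ≤ _ := by gcongr

variable {α L : ℝ}

theorem sampleSize_eq (hL : 0 < L) (hα : α = Real.exp (-L)) :
    sampleSize α = 60 * Real.exp L * (L ^ 2 * L ^ (3 / 2 : ℝ)) := by
  rw [sampleSize, hα, Real.log_exp, abs_neg, abs_of_pos hL, rpow_seven_half hL, Real.exp_neg]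
  field_simp

theorem one_div_eq_exp (hα : α = Real.exp (-L)) : 1 / α = Real.exp L := by
  rw [hα, Real.exp_neg, one_div, inv_inv]

theorem accuracy_eq (hL : 0 < L) (hα : α = Real.exp (-L)) :
    accuracy α = ⌈30 * Real.exp L * L ^ (3 / 2 : ℝ)⌉₊ := by
  rw [accuracy, one_div_eq_exp hα, Real.log_exp, abs_of_pos hL]

theorem log_sampleSize_le (hL : 65536 ≤ L) (hα : α = Real.exp (-L)) :
    Real.log (sampleSize α) ≤ 2 * L := by
  have h0 : 0 < L := by linarith
  rw [sampleSize_eq h0 hα, ← rpow_seven_half h0, Real.log_mul (by positivity) (by positivity),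
    Real.log_mul (by norm_num) (by positivity), Real.log_exp, Real.log_rpow h0]
  have h1 := log_le_div_add h0 (b := 16) (by norm_num)
  have h2 := Real.log_le_sub_one_of_pos (x := 60) (by norm_num)
  linarith

theorem sampleSize_le_exp (hL : 65536 ≤ L) (hα : α = Real.exp (-L)) :
    sampleSize α ≤ Real.exp (2 * L) := by
  have h0 : 0 < L := by linarith
  have hs : 0 < sampleSize α := by rw [sampleSize_eq h0 hα]; positivity
  exact (Real.log_le_iff_le_exp hs).1 (log_sampleSize_le hL hα)

theorem numRounds_le (hL : 65536 ≤ L) (hα : α = Real.exp (-L)) :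
    (numRounds α : ℝ) ≤ 9 * L := by
  have h1 := log_sampleSize_le hL hα
  have h2 : Real.logb 2 (sampleSize α) ≤ 4 * L := by
    have := Real.log_two_gt_d9
    rw [Real.logb, div_le_iff₀ (by linarith)]
    nlinarith
  rcases le_or_gt (2 * Real.logb 2 (sampleSize α)) 0 with h | h
  · rw [numRounds, Nat.ceil_eq_zero.2 h, Nat.cast_zero]; linarith
  · have := Nat.ceil_lt_add_one h.le
    rw [numRounds]; linarith

theorem half_pow_numRounds_le (hs : 0 < sampleSize α) :
    (1 / 2 : ℝ≥0∞) ^ numRounds α ≤ ENNReal.ofReal (1 / sampleSize α ^ 2) := by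
  have h : (1 / 2 : ℝ≥0∞) = ENNReal.ofReal (1 / 2) := by
    rw [ENNReal.ofReal_div_of_pos (by norm_num)]; simp
  rw [h, ← ENNReal.ofReal_pow (by norm_num)]
  refine ENNReal.ofReal_le_ofReal ?_
  rw [one_div, one_div, inv_pow]
  refine inv_anti₀ (by positivity) ?_
  calc sampleSize α ^ 2 = (2 : ℝ) ^ (2 * Real.logb 2 (sampleSize α)) := by
        rw [mul_comm, Real.rpow_mul (by norm_num),
          Real.rpow_logb (by norm_num) (by norm_num) hs, Real.rpow_two]
    _ ≤ (2 : ℝ) ^ (numRounds α : ℝ) :=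
        Real.rpow_le_rpow_of_exponent_le (by norm_num) (Nat.le_ceil _)
    _ = 2 ^ numRounds α := Real.rpow_natCast _ _

theorem le_accuracy (hL : 0 < L) (hα : α = Real.exp (-L)) :
    30 * Real.exp L * L ^ (3 / 2 : ℝ) ≤ accuracy α := by
  rw [accuracy_eq hL hα]; exact Nat.le_ceil _

theorem one_le_rpow_three_half (hL : 65536 ≤ L) : 1 ≤ L ^ (3 / 2 : ℝ) := by
  have := mul_le_rpow_three_half hL
  linarith

theorem accuracy_le (hL : 65536 ≤ L) (hα : α = Real.exp (-L)) :
    (accuracy α : ℝ) ≤ 31 * Real.exp L * L ^ (3 / 2 : ℝ) := by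
  have h0 : 0 < L := by linarith
  have h1 := one_le_rpow_three_half hL
  have h2 : 1 ≤ Real.exp L := Real.one_le_exp h0.le
  have h3 : 1 ≤ Real.exp L * L ^ (3 / 2 : ℝ) := one_le_mul_of_one_le_of_one_le h2 h1
  have h4 := Nat.ceil_lt_add_one (a := 30 * Real.exp L * L ^ (3 / 2 : ℝ)) (by positivity)
  rw [accuracy_eq h0 hα]
  linarith

theorem numTests_le_accuracy (hL : 65536 ≤ L) (hα : α = Real.exp (-L)) :
    numTests α ≤ accuracy α := by
  rw [numTests, one_div_eq_exp hα, accuracy_eq (by linarith) hα]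
  refine Nat.ceil_le_ceil ?_
  have h1 := one_le_rpow_three_half hL
  have := Real.exp_pos L
  nlinarith

/-- The exponent `7/2 = 2 + 3/2` in `s` leaves room for two factors `L` beyond `l`: one for the
number of rounds and one for the multiplicity bound `log l`. -/
theorem accuracy_mul_le (hL : 65536 ≤ L) (hα : α = Real.exp (-L)) :
    accuracy α * L ^ 2 ≤ 31 / 60 * sampleSize α := by
  rw [sampleSize_eq (by linarith) hα]
  have := mul_le_mul_of_nonneg_right (accuracy_le hL hα) (sq_nonneg L)
  linarith

theorem accuracy_mul_le_exp (hL : 65536 ≤ L) (hα : α = Real.exp (-L)) {p : ℝ}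
    (hp : p ≤ 1 / (2 * sampleSize α)) : accuracy α * p ≤ Real.exp (-11) := by
  have h0 : 0 < L := by linarith
  have hs : 0 < sampleSize α := by rw [sampleSize_eq h0 hα]; positivity
  have h1 : (accuracy α : ℝ) * p ≤ accuracy α * (1 / (2 * sampleSize α)) := by gcongr
  -- Since `l·L² ≤ (31/60)·s`, the product `l/(2s)` is of order `1/L²`, which `L ≥ 65536` makes
  -- smaller than `e^(-11)`.
  have h2 : Real.exp 11 ≤ L ^ 2 := by
    have h3 : Real.exp 11 ≤ 3 ^ 11 := by
      rw [show (11 : ℝ) = (11 : ℕ) * 1 by norm_num, Real.exp_nat_mul]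
      have := Real.exp_one_lt_d9
      exact pow_le_pow_left₀ (Real.exp_pos _).le (by linarith) _
    nlinarith
  refine h1.trans ?_
  rw [Real.exp_neg, mul_one_div, div_le_iff₀ (by positivity), ← div_eq_inv_mul,
    le_div_iff₀ (Real.exp_pos _)]
  have h4 := mul_le_mul_of_nonneg_left h2 (Nat.cast_nonneg (α := ℝ) (accuracy α))
  have h5 := accuracy_mul_le hL hα
  linarith

theorem log_accuracy_mem (hL : 65536 ≤ L) (hα : α = Real.exp (-L)) :
    L ≤ Real.log (accuracy α) ∧ Real.log (accuracy α) ≤ 2 * L := by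
  have h0 : 0 < L := by linarith
  have h1 := one_le_rpow_three_half hL
  have h2 := Real.exp_pos L
  have h3 : Real.exp L ≤ accuracy α := le_trans (by nlinarith) (le_accuracy h0 hα)
  have hl : (0 : ℝ) < accuracy α := h2.trans_le h3
  refine ⟨(Real.le_log_iff_exp_le hl).2 h3, (Real.log_le_log hl ?_).trans
    (log_sampleSize_le hL hα)⟩
  have h4 := accuracy_mul_le hL hα
  have h5 : (accuracy α : ℝ) ≤ accuracy α * L ^ 2 :=
    le_mul_of_one_le_right hl.le (one_le_pow₀ (by linarith))
  linarith

theorem cost_le (hL : 65536 ≤ L) (hα : α = Real.exp (-L)) :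
    numRounds α * (3 * (accuracy α + accuracy α * Real.log (accuracy α))) +
      (2 * accuracy α + 2 * numTests α * Real.log (accuracy α)) ≤ 47 * sampleSize α := by
  have h0 : 0 < L := by linarith
  have h1 := (log_accuracy_mem hL hα).2
  have h1' : 0 ≤ Real.log (accuracy α) := Real.log_natCast_nonneg _
  have h2 := numRounds_le hL hα
  have h3 := accuracy_mul_le hL hα
  have h4 : (numTests α : ℝ) ≤ accuracy α := by exact_mod_cast numTests_le_accuracy hL hα
  set l : ℝ := (accuracy α : ℝ)
  have hl : 0 ≤ l := Nat.cast_nonneg _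
  have hlL : l ≤ l * L := le_mul_of_one_le_right hl (by linarith)
  have hlL2 : l * L ≤ l * L ^ 2 := by gcongr; nlinarith
  -- The total is at most `87·l·L²`, and `87·31/60 < 47`.
  calc _ ≤ 9 * L * (3 * (l * L + l * (2 * L))) + (2 * (l * L ^ 2) + 2 * l * (2 * L)) := by
        gcongr
        linarith
    _ = 81 * (l * L ^ 2) + 2 * (l * L ^ 2) + 4 * (l * L) := by ring
    _ ≤ _ := by nlinarith

theorem tail_le (hL : 65536 ≤ L) (hα : α = Real.exp (-L)) :
    -(numTests α * accuracy α * α ^ 2 / 768) ≤ -(10 * L) := by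
  have h0 : 0 < L := by linarith
  have hα0 : 0 < α := hα ▸ Real.exp_pos _
  have hαL : α * Real.exp L = 1 := by rw [hα, ← Real.exp_add]; simp
  have h1 : Real.exp L ≤ numTests α := by
    rw [numTests, one_div_eq_exp hα]; exact Nat.le_ceil _
  have h2 := le_accuracy h0 hα
  have h3 := mul_le_rpow_three_half hL
  have h4 : Real.exp L * (30 * Real.exp L * L ^ (3 / 2 : ℝ)) * α ^ 2 ≤
      numTests α * accuracy α * α ^ 2 := by gcongr
  have h5 : Real.exp L * (30 * Real.exp L * L ^ (3 / 2 : ℝ)) * α ^ 2 =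
      30 * L ^ (3 / 2 : ℝ) * (α * Real.exp L) ^ 2 := by ring
  rw [h5, hαL, one_pow, mul_one] at h4
  linarith

theorem numRounds_mul_eexp_le (hL : 65536 ≤ L) (hα : α = Real.exp (-L)) {j : ℕ}
    (hj : (j : ℝ) ≤ 9 * L) : j * eexp (11 - 10 * L) ≤ ENNReal.ofReal (1 / sampleSize α ^ 2) := by
  have h0 : 0 < L := by linarith
  have hs : 0 < sampleSize α := by rw [sampleSize_eq h0 hα]; positivity
  rw [← ENNReal.ofReal_natCast, eexp, ← ENNReal.ofReal_mul (by positivity)]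
  refine ENNReal.ofReal_le_ofReal ?_
  -- The slack is ample: `e^(22 - 9L)` is compared with `1/s² ≥ e^(-4L)`.
  have h1 : (j : ℝ) ≤ Real.exp L * Real.exp 11 := by
    rw [← Real.exp_add]
    have := Real.quadratic_le_exp_of_nonneg (x := L + 11) (by linarith)
    nlinarith
  calc (j : ℝ) * Real.exp (11 - 10 * L) ≤
        Real.exp L * Real.exp 11 * Real.exp (11 - 10 * L) := by gcongr
    _ = Real.exp (22 - 9 * L) := by rw [← Real.exp_add, ← Real.exp_add]; ring_nf
    _ ≤ Real.exp (-(2 * (2 * L))) := Real.exp_le_exp.2 (by linarith)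
    _ = 1 / Real.exp (2 * L) ^ 2 := by
        rw [Real.exp_neg, ← Real.exp_nat_mul, one_div]; norm_num
    _ ≤ _ := by
        gcongr
        exact sampleSize_le_exp hL hα

theorem total_error_le (hL : 65536 ≤ L) (hα : α = Real.exp (-L)) :
    numRounds α * (3 * eexp (11 - 10 * L)) +
      ((1 / 2) ^ numRounds α + (1 / 2) ^ numRounds α) +
      ((2 * eexp (11 - 10 * L) + 2 * eexp (11 - 10 * L)) +
        numRounds α * (2 * eexp (11 - 10 * L))) ≤
      ENNReal.ofReal (11 / sampleSize α ^ 2) := by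
  have h0 : 0 < L := by linarith
  have hs : 0 < sampleSize α := by rw [sampleSize_eq h0 hα]; positivity
  have h1 := numRounds_mul_eexp_le hL hα (numRounds_le hL hα)
  have h2 := numRounds_mul_eexp_le hL hα (j := 1) (by push_cast; linarith)
  have h3 := half_pow_numRounds_le hs
  rw [Nat.cast_one, one_mul] at h2
  have h4 : ENNReal.ofReal (11 / sampleSize α ^ 2) =
      11 * ENNReal.ofReal (1 / sampleSize α ^ 2) := by
    rw [div_eq_mul_one_div, ENNReal.ofReal_mul (by norm_num)]; simp
  rw [h4]
  set E := ENNReal.ofReal (1 / sampleSize α ^ 2)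
  calc _ = 5 * (numRounds α * eexp (11 - 10 * L)) +
        ((1 / 2) ^ numRounds α + (1 / 2) ^ numRounds α) + 4 * eexp (11 - 10 * L) := by ring
    _ ≤ 5 * E + (E + E) + 4 * E := by gcongr
    _ = _ := by ring

end Parameters

/-! ### Small `α`, and the conclusion -/

theorem one_sub_le_successProb_of_small {n : ℕ} {α L : ℝ} (P Q : PMF (Fin n)) (hL : 65536 ≤ L)
    (hα : α = Real.exp (-L))
    (hsep : α ≤ ‖probVec P - probVec Q‖ ^ 2 / ‖probVec P + probVec Q‖)
    (hP : ∀ i, (P i).toReal ≤ 1 / (2 * sampleSize α))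
    (hQ : ∀ i, (Q i).toReal ≤ 1 / (2 * sampleSize α)) :
    1 - 11 / sampleSize α ^ 2 ≤ successProb α P Q P Verdict.isP (47 * sampleSize α) ∧
    1 - 11 / sampleSize α ^ 2 ≤ successProb α P Q Q Verdict.isQ (47 * sampleSize α) := by
  have hα0 : 0 < α := hα ▸ Real.exp_pos _
  have ha0 := norm_probVec_add_pos P Q
  have hsq := sq_norm_probVec_add P Q
  rw [le_div_iff₀ ha0, sq_norm_probVec_sub] at hsep
  set a := ‖probVec P + probVec Q‖
  have hpq := sum_toReal_mul_nonneg P Q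
  have hpp := sum_toReal_mul_nonneg P P
  have hqq := sum_toReal_mul_nonneg Q Q
  have hswap : ∑ x, (Q x).toReal * (P x).toReal = ∑ x, (P x).toReal * (Q x).toReal :=
    Finset.sum_congr rfl fun x _ => mul_comm _ _
  -- Since `⟨P,Q⟩ ≥ 0`, `αa ≤ ‖P - Q‖² ≤ ‖P + Q‖² = a²`.
  have ha : α ≤ a := by
    refine le_of_mul_le_mul_right ?_ ha0
    nlinarith
  obtain ⟨hlog1, -⟩ := log_accuracy_mem hL hα
  have hl2 : 2 ≤ accuracy α := by
    by_contra h
    have h' : Real.log (accuracy α) ≤ 0 :=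
      Real.log_nonpos (Nat.cast_nonneg _) (by exact_mod_cast (by omega : accuracy α ≤ 1))
    linarith
  have hlP : ∀ i, accuracy α * (P i).toReal ≤ Real.exp (-11) := fun i =>
    accuracy_mul_le_exp hL hα (hP i)
  have hlQ : ∀ i, accuracy α * (Q i).toReal ≤ Real.exp (-11) := fun i =>
    accuracy_mul_le_exp hL hα (hQ i)
  have he : Real.exp (-11) ≤ 1 := Real.exp_le_one_iff.2 (by norm_num)
  have hφ : eexp (11 - 10 * Real.log (accuracy α)) ≤ eexp (11 - 10 * L) :=
    eexp_mono (by linarith)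
  have hη : eexp (-(numTests α * accuracy α * α ^ 2 / 768)) ≤ eexp (11 - 10 * L) :=
    eexp_mono (by linarith [tail_le hL hα])
  have fP := fun m => (expect_log_le_maxCount_le P hl2 hlP m).trans hφ
  have fQ := fun m => (expect_log_le_maxCount_le Q hl2 hlQ m).trans hφ
  have htot := total_error_le hL hα
  constructor
  · refine one_sub_le_successProb (by positivity) (le_trans ?_ htot)
    exact expect_distinguish_left_le hα0 ha (by omega) (numTests_le_accuracy hL hα)
      (fun i => (hlP i).trans he) (fun i => (hlQ i).trans he) (by linarith) (by linarith)
      (by linarith) (by linarith) fP fQ hη (cost_le hL hα)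
  · refine one_sub_le_successProb (by positivity) (le_trans ?_ htot)
    exact expect_distinguish_right_le hα0 ha (by omega) (numTests_le_accuracy hL hα)
      (fun i => (hlP i).trans he) (fun i => (hlQ i).trans he) (by linarith) (by linarith)
      (by linarith) hsep fP fQ hη (cost_le hL hα)

theorem successProb_mono {n : ℕ} {α N N' : ℝ} (P Q T : PMF (Fin n)) (v : Verdict) (h : N ≤ N') :
    successProb α P Q T v N ≤ successProb α P Q T v N' := by
  refine ENNReal.toReal_mono ?_ (MeasureTheory.measure_mono fun ω hω => ⟨hω.1, hω.2.trans h⟩)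
  refine ne_top_of_le_ne_top ENNReal.one_ne_top ?_
  rw [PMF.toOuterMeasure_apply, ← (runSampler (algorithm α P Q T)).tsum_coe]
  exact ENNReal.tsum_le_tsum fun ω => Set.indicator_le_self _ _ ω

end Distinguishing

theorem mainTheorem1 :
    ∃ c : ℝ, 0 < c ∧
      ∀ (n : ℕ) (α : ℝ) (P Q : PMF (Fin n)),
        0 < α → α ≠ 1 →
        α ≤ ‖Distinguishing.probVec P - Distinguishing.probVec Q‖ ^ 2 /
              ‖Distinguishing.probVec P + Distinguishing.probVec Q‖ →
        (∀ i, (P i).toReal ≤ 1 / (2 * Distinguishing.sampleSize α) ∧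
              (Q i).toReal ≤ 1 / (2 * Distinguishing.sampleSize α)) →
        1 - c / Distinguishing.sampleSize α ^ 2 ≤
            Distinguishing.successProb α P Q P Distinguishing.Verdict.isP
              (c * Distinguishing.sampleSize α) ∧
        1 - c / Distinguishing.sampleSize α ^ 2 ≤
            Distinguishing.successProb α P Q Q Distinguishing.Verdict.isQ
              (c * Distinguishing.sampleSize α) := by
  set S : ℝ := 60 * (65536 ^ (7 / 2 : ℝ) * Real.exp 65536)
  -- The summand 47 covers the sample cost and the error constant 11 for small `α`. The summand `S²`
  -- makes `1 - c/s²` nonpositive whenever `s ≤ S`.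
  refine ⟨47 + S ^ 2, by positivity, fun n α P Q hα h1 hsep hPQ => ?_⟩
  have hs := Distinguishing.sampleSize_pos hα h1
  have hS : 0 ≤ S ^ 2 := sq_nonneg S
  rcases le_or_gt (-65536) (Real.log α) with h | h
  · have hsS : Distinguishing.sampleSize α ≤ S := Distinguishing.sampleSize_le_of_le hα h
    have h2 : 1 ≤ (47 + S ^ 2) / Distinguishing.sampleSize α ^ 2 := by
      rw [le_div_iff₀ (by positivity), one_mul]
      have := pow_le_pow_left₀ hs.le hsS 2
      linarith
    exact ⟨(sub_nonpos.2 h2).trans ENNReal.toReal_nonneg,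
      (sub_nonpos.2 h2).trans ENNReal.toReal_nonneg⟩
  · have hαL : α = Real.exp (-(-Real.log α)) := by rw [neg_neg, Real.exp_log hα]
    obtain ⟨hP, hQ⟩ := Distinguishing.one_sub_le_successProb_of_small P Q (by linarith) hαL hsep
      (fun i => (hPQ i).1) (fun i => (hPQ i).2)
    have h2 : 1 - (47 + S ^ 2) / Distinguishing.sampleSize α ^ 2 ≤
        1 - 11 / Distinguishing.sampleSize α ^ 2 := by
      gcongr
      linarith
    have h3 : 47 * Distinguishing.sampleSize α ≤ (47 + S ^ 2) * Distinguishing.sampleSize α := by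
      gcongr
      linarith
    exact ⟨h2.trans (hP.trans (Distinguishing.successProb_mono _ _ _ _ h3)),
      h2.trans (hQ.trans (Distinguishing.successProb_mono _ _ _ _ h3))⟩
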